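/- Let $\mathbb{K}$ be a field of characteristic zero and $\mathcal{D}$ a nonempty set; $\mathbb{K}(X)$ denotes the vector space with basis $X$. Let $\mathbf{C}^{\mathcal{D}}_{CK}$ be the Hopf algebra of contractions. As a vector space it is spanned by the (non-planar) rooted forests with edges decorated by $\mathcal{D}$, the one-vertex tree being identified with the unit $1$; equivalently, as an algebra (the product being the concatenation of forests) it is the polynomial algebra on the set $\mathbb{T}^{\mathcal{D}}$ of rooted trees with at least one edge and with edges decorated by $\mathcal{D}$. Its coproduct is $$\Delta(F)=\sum_{\boldsymbol{e}\subseteq E(F)} \mathrm{Part}_{\boldsymbol{e}}(F)\otimes \mathrm{Cont}_{\boldsymbol{e}}(F),$$ where $\mathrm{Part}_{\boldsymbol{e}}(F)$ is the forest obtained from $F$ by keeping all vertices and only the edges in $\boldsymbol{e}$, and $\mathrm{Cont}_{\boldsymbol{e}}(F)$ is the forest obtained from $F$ by contracting all the edges in $\boldsymbol{e}$; its counit sends $1$ to $1$ and every other forest to $0$. Let $\mathbf{Sh}^{\mathcal{D}}$ be the shuffle Hopf algebra: the vector space spanned by the words in the alphabet $\mathcal{D}$, with the shuffle product and the deconcatenation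 coproduct $\Delta(v_1\cdots v_n)=\sum_{i=0}^n v_1\cdots v_i\otimes v_{i+1}\cdots v_n$. If $\mathcal{D}$ is equipped with an associative and commutative product $(a,b)\mapsto [ab]\in\mathcal{D}$, let $\mathbf{Csh}^{\mathcal{D}}$ be the quasi-shuffle Hopf algebra: the same coalgebra, with the product for which the empty word is the unit and $$au * bv = a(u * bv) + b(au * v) + [ab](u * v)$$ for all letters $a,b$ and words $u,v$. In both cases let $\pi$ be the linear projection onto $\mathbb{K}(\mathcal{D})$ which sends a one-letter word to its letter and every other word to $0$. Let $\varphi:\mathbb{K}(\mathbb{T}^{\mathcal{D}})\to\mathbb{K}(\mathcal{D})$ be any linear map, and let $i:\mathbb{K}(\mathbb{T}^{\mathcal{D}})\hookrightarrow \mathbf{C}^{\mathcal{D}}_{CK}$ be the inclusion. Then: 1. there exists a unique Hopf algebra morphism $\Phi:\mathbf{C}^{\mathcal{D}}_{CK}\to\mathbf{Sh}^{\mathcal{D}}$ such that $\pi\circ\Phi\circ i=\varphi$; 2. for every associative and commutative product $[\cdot,\cdot]:\mathcal{D}^2\to\mathcal{D}$, there exists a unique Hopf algebra morphism $\Phi:\mathbf{C}^{\mathcal{D}}_{CK}\to\mathbf{Csh}^{\mathcal{D}}$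 such that $\pi\circ\Phi\circ i=\varphi$. -/

import Mathlib

open scoped TensorProduct

/-- Planar rooted trees with edges decorated by `D`: `nil` is the tree with a single vertex and
no edge, and `graft d t s` is obtained from `s` by joining the root of `t` to the root of `s`, as
its leftmost child, by a new edge decorated by `d`. So there is one `graft` per edge. -/
inductive PlanarTree (D : Type*) where
  | nil : PlanarTree D
  | graft (d : D) (t s : PlanarTree D) : PlanarTree D

namespace PlanarTree

variable {D : Type*}

/-- Exchange of two adjacent siblings (with the edges and subtrees above them), anywhere in a
planar tree. -/
inductive Swap : PlanarTree D → PlanarTree D → Prop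
  | swap (d d' : D) (t t' s : PlanarTree D) :
      Swap (graft d t (graft d' t' s)) (graft d' t' (graft d t s))
  | left (d : D) {t t' : PlanarTree D} (s : PlanarTree D) (h : Swap t t') :
      Swap (graft d t s) (graft d t' s)
  | right (d : D) (t : PlanarTree D) {s s' : PlanarTree D} (h : Swap s s') :
      Swap (graft d t s) (graft d t s')

/-- The type of edges of a planar tree. For `graft d t s`, the edge `none` is the one which joins
the root of `t` to the root of `s`. -/
def Edge : PlanarTree D → Type
  | nil => Empty
  | graft _ t s => Option (Edge t ⊕ Edge s)

/-- A planar tree has finitely many edges. -/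
noncomputable instance Edge.fintype : (t : PlanarTree D) → Fintype (Edge t)
  | nil => inferInstanceAs (Fintype Empty)
  | graft _ t s =>
    letI := Edge.fintype t
    letI := Edge.fintype s
    inferInstanceAs (Fintype (Option (Edge t ⊕ Edge s)))

/-- The edges of `t` in a set of edges of `graft d t s`. -/
def Edge.onLeft {d : D} {t s : PlanarTree D} (e : Set (Edge (graft d t s))) : Set (Edge t) :=
  {x | (some (Sum.inl x) : Option (Edge t ⊕ Edge s)) ∈ e}

/-- The edges of `s` in a set of edges of `graft d t s`. -/
def Edge.onRight {d : D} {t s : PlanarTree D} (e : Set (Edge (graft d t s))) : Set (Edge s) :=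
  {x | (some (Sum.inr x) : Option (Edge t ⊕ Edge s)) ∈ e}

/-- The new edge of `graft d t s`. -/
def Edge.new (d : D) (t s : PlanarTree D) : Edge (graft d t s) :=
  (none : Option (Edge t ⊕ Edge s))

/-- The planar tree obtained by identifying the roots of two planar trees. -/
def merge : PlanarTree D → PlanarTree D → PlanarTree D
  | nil, u => u
  | graft d t s, u => graft d t (merge s u)

open Classical in
/-- The contracted tree `Cont_e(t)`: every edge in `e` is contracted, its two ends being
identified. The other edges keep their decorations. -/
noncomputable def cont : (t : PlanarTree D) → Set (Edge t) → PlanarTree D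
  | nil, _ => nil
  | graft d t s, e =>
    if Edge.new d t s ∈ e then merge (cont t (Edge.onLeft e)) (cont s (Edge.onRight e))
    else graft d (cont t (Edge.onLeft e)) (cont s (Edge.onRight e))

open Classical in
/-- The connected component of the root in the forest `Part_e(t)`, which is obtained from `t` by
keeping all the vertices and only the edges in `e`. -/
noncomputable def rootPart : (t : PlanarTree D) → Set (Edge t) → PlanarTree D
  | nil, _ => nil
  | graft d t s, e =>
    if Edge.new d t s ∈ e then graft d (rootPart t (Edge.onLeft e)) (rootPart s (Edge.onRight e))
    else rootPart s (Edge.onRight e)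

open Classical in
/-- The connected components of the forest `Part_e(t)` which do not contain the root of `t`. -/
noncomputable def otherParts : (t : PlanarTree D) → Set (Edge t) → Multiset (PlanarTree D)
  | nil, _ => 0
  | graft d t s, e =>
    if Edge.new d t s ∈ e then otherParts t (Edge.onLeft e) + otherParts s (Edge.onRight e)
    else rootPart t (Edge.onLeft e) ::ₘ
      (otherParts t (Edge.onLeft e) + otherParts s (Edge.onRight e))

/-- The forest `Part_e(t)`, as the multiset of its connected components. -/
noncomputable def part (t : PlanarTree D) (e : Set (Edge t)) : Multiset (PlanarTree D) :=
  rootPart t e ::ₘ otherParts t e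

/-- The number of edges. -/
def numEdges : PlanarTree D → ℕ
  | nil => 0
  | graft _ t s => numEdges t + numEdges s + 1

theorem card_edge (t : PlanarTree D) : Fintype.card (Edge t) = numEdges t := by
  induction t with
  | nil => rfl
  | graft d t s iht ihs =>
    have h : Fintype.card (Edge (graft d t s)) = Fintype.card (Option (Edge t ⊕ Edge s)) := rfl
    rw [h, Fintype.card_option, Fintype.card_sum, iht, ihs, numEdges]

theorem Swap.numEdges_eq {t t' : PlanarTree D} (h : Swap t t') : numEdges t = numEdges t' := by
  induction h with
  | swap d d' t t' s => simp only [numEdges]; omega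
  | left d s h ih => simp only [numEdges, ih]
  | right d t h ih => simp only [numEdges, ih]

theorem Swap.merge_left {t t' : PlanarTree D} (h : Swap t t') (u : PlanarTree D) :
    Swap (merge t u) (merge t' u) := by
  induction h with
  | swap d d' t t' s => exact Swap.swap d d' t t' (merge s u)
  | left d s h ih => exact Swap.left d (merge s u) h
  | right d t h ih => exact Swap.right d t ih

theorem Swap.merge_right (t : PlanarTree D) {u u' : PlanarTree D} (h : Swap u u') :
    Swap (merge t u) (merge t u') := by
  induction t with
  | nil => exact h
  | graft d t s iht ihs => exact Swap.right d t ihs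

/-- A set of edges of `graft d t s` amounts to a set of edges of `t`, a set of edges of `s` and a
decision for the new edge. -/
noncomputable def edgeSetEquiv (d : D) (t s : PlanarTree D) :
    Set (Edge (graft d t s)) ≃ Set (Edge t) × Set (Edge s) × Prop where
  toFun e := (Edge.onLeft e, Edge.onRight e, Edge.new d t s ∈ e)
  invFun p := {x | (show Option (Edge t ⊕ Edge s) from x).elim p.2.2
    (Sum.elim (fun y => y ∈ p.1) (fun y => y ∈ p.2.1))}
  left_inv e := by
    ext x
    change Option (Edge t ⊕ Edge s) at x
    rcases x with _ | x | x <;> rfl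
  right_inv p := rfl

end PlanarTree

/-- Rooted trees (not planar, up to isomorphism) with edges decorated by `D`: planar rooted trees
up to permutations of siblings. -/
def RTree (D : Type*) : Type _ := Quot (PlanarTree.Swap (D := D))

namespace RTree

open PlanarTree

variable {D : Type*}

/-- The rooted tree underlying a planar rooted tree. -/
def mk (t : PlanarTree D) : RTree D := Quot.mk _ t

/-- The tree with a single vertex. -/
def nil : RTree D := mk PlanarTree.nil

/-- The number of edges. -/
def numEdges : RTree D → ℕ := Quot.lift PlanarTree.numEdges fun _ _ h => h.numEdges_eq

/-- Grafting by a new edge at the root. -/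
def graft (d : D) : RTree D → RTree D → RTree D :=
  Quot.map₂ (PlanarTree.graft d) (fun t _ _ h => Swap.right d t h) (fun _ _ s h => Swap.left d s h)

/-- Identification of the roots. -/
def merge : RTree D → RTree D → RTree D :=
  Quot.map₂ PlanarTree.merge (fun t _ _ h => Swap.merge_right t h)
    (fun _ _ s h => Swap.merge_left h s)

theorem mk_graft (d : D) (t s : PlanarTree D) :
    mk (PlanarTree.graft d t s) = graft d (mk t) (mk s) := rfl

theorem mk_merge (t s : PlanarTree D) :
    mk (PlanarTree.merge t s) = merge (mk t) (mk s) := rfl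

theorem ind {P : RTree D → Prop} (hn : P nil) (hg : ∀ d T S, P T → P S → P (graft d T S))
    (T : RTree D) : P T := by
  induction T using Quot.ind with
  | mk t =>
    induction t with
    | nil => exact hn
    | graft d t s iht ihs => exact hg d _ _ iht ihs

theorem numEdges_mk (t : PlanarTree D) : numEdges (mk t) = t.numEdges := rfl

@[simp] theorem numEdges_nil : numEdges (nil : RTree D) = 0 := rfl

@[simp] theorem numEdges_graft (d : D) (T S : RTree D) :
    numEdges (graft d T S) = numEdges T + numEdges S + 1 := by
  induction T using Quot.ind
  induction S using Quot.ind
  rfl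

theorem graft_ne_nil (d : D) (T S : RTree D) : graft d T S ≠ nil := by
  intro h
  have := congrArg numEdges h
  simp at this

theorem numEdges_eq_zero {T : RTree D} : numEdges T = 0 ↔ T = nil := by
  constructor
  · induction T using ind with
    | hn => intro; rfl
    | hg d T S _ _ => intro h; simp at h
  · rintro rfl; rfl

theorem graft_comm (d d' : D) (T T' S : RTree D) :
    graft d T (graft d' T' S) = graft d' T' (graft d T S) := by
  induction T using Quot.ind
  induction T' using Quot.ind
  induction S using Quot.ind
  exact Quot.sound (Swap.swap _ _ _ _ _)

@[simp] theorem nil_merge (T : RTree D) : merge nil T = T := by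
  induction T using Quot.ind
  rfl

@[simp] theorem graft_merge (d : D) (T S U : RTree D) :
    merge (graft d T S) U = graft d T (merge S U) := by
  induction T using Quot.ind
  induction S using Quot.ind
  induction U using Quot.ind
  rfl

@[simp] theorem merge_nil (T : RTree D) : merge T nil = T := by
  induction T using ind with
  | hn => simp
  | hg d T S _ h => simp [h]

@[simp] theorem merge_graft (d : D) (T S U : RTree D) :
    merge U (graft d T S) = graft d T (merge U S) := by
  induction U using ind with
  | hn => simp
  | hg d' T' S' _ h => simp [h, graft_comm d d']

theorem merge_assoc (T S U : RTree D) : merge (merge T S) U = merge T (merge S U) := by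
  induction T using ind with
  | hn => simp
  | hg d' T' S' _ h => simp [h]

theorem merge_comm (T S : RTree D) : merge T S = merge S T := by
  induction T using ind with
  | hn => simp
  | hg d' T' S' _ h => simp [h]

theorem merge_left_comm (T S U : RTree D) : merge T (merge S U) = merge S (merge T U) := by
  rw [← merge_assoc, merge_comm T S, merge_assoc]

@[simp] theorem numEdges_merge (T S : RTree D) :
    numEdges (merge T S) = numEdges T + numEdges S := by
  induction T using ind with
  | hn => simp
  | hg d' T' S' _ h => simp [h]; omega

end RTree

namespace PlanarTree

variable {D : Type*} {M : Type*} [AddCommMonoid M]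

/-- The sum of `g R Q C` over all sets `e` of edges of `t`, where `R` is the component of the root
in `Part_e(t)`, `Q` is the multiset of the other components, and `C = Cont_e(t)`. -/
noncomputable def edgeSum (t : PlanarTree D) (g : RTree D → Multiset (RTree D) → RTree D → M) : M :=
  ∑ e : Set (Edge t),
    g (RTree.mk (rootPart t e)) ((otherParts t e).map RTree.mk) (RTree.mk (cont t e))

theorem edgeSum_nil (g : RTree D → Multiset (RTree D) → RTree D → M) :
    edgeSum nil g = g RTree.nil 0 RTree.nil := by
  have : Unique (Set (Edge (nil : PlanarTree D))) :=
    inferInstanceAs (Unique (Set Empty))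
  rw [edgeSum, Fintype.sum_unique]
  rfl

theorem edgeSum_graft (d : D) (t s : PlanarTree D)
    (g : RTree D → Multiset (RTree D) → RTree D → M) :
    edgeSum (graft d t s) g = edgeSum t fun R Q C => edgeSum s fun R' Q' C' =>
      g (RTree.graft d R R') (Q + Q') (RTree.merge C C') +
      g R' (R ::ₘ (Q + Q')) (RTree.graft d C C') := by
  classical
  rw [edgeSum, ← (edgeSetEquiv d t s).symm.sum_comp, Fintype.sum_prod_type]
  simp only [edgeSum]
  refine Finset.sum_congr rfl fun e _ => ?_
  rw [Fintype.sum_prod_type]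
  refine Finset.sum_congr rfl fun e' _ => ?_
  rw [Fintype.univ_Prop, Finset.sum_insert (by simp), Finset.sum_singleton]
  have h1 : ∀ p, Edge.onLeft ((edgeSetEquiv d t s).symm (e, e', p)) = e := fun p =>
    congrArg (·.1) ((edgeSetEquiv d t s).apply_symm_apply (e, e', p))
  have h2 : ∀ p, Edge.onRight ((edgeSetEquiv d t s).symm (e, e', p)) = e' := fun p =>
    congrArg (·.2.1) ((edgeSetEquiv d t s).apply_symm_apply (e, e', p))
  have h3 : ∀ p, (Edge.new d t s ∈ (edgeSetEquiv d t s).symm (e, e', p)) = p := fun p =>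
    congrArg (·.2.2) ((edgeSetEquiv d t s).apply_symm_apply (e, e', p))
  simp only [rootPart, otherParts, cont, h1, h2, h3, if_true, if_false, RTree.mk_graft,
    RTree.mk_merge, Multiset.map_add, Multiset.map_cons]

theorem edgeSum_comm (t s : PlanarTree D)
    (g : RTree D → Multiset (RTree D) → RTree D → RTree D → Multiset (RTree D) → RTree D → M) :
    (edgeSum t fun R Q C => edgeSum s fun R' Q' C' => g R Q C R' Q' C') =
      edgeSum s fun R' Q' C' => edgeSum t fun R Q C => g R Q C R' Q' C' :=
  Finset.sum_comm

theorem Swap.edgeSum_eq {t t' : PlanarTree D} (h : Swap t t') :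
    ∀ g : RTree D → Multiset (RTree D) → RTree D → M, edgeSum t g = edgeSum t' g := by
  induction h with
  | swap d d' t t' s =>
    intro g
    simp only [edgeSum_graft]
    rw [edgeSum_comm t t']
    congr! 12 with R Q C R' Q' C' R'' Q'' C''
    rw [RTree.graft_comm d d', RTree.graft_comm d d', RTree.merge_left_comm C' C,
      RTree.merge_graft, RTree.merge_graft, Multiset.add_cons, Multiset.add_cons,
      Multiset.cons_swap R' R, add_left_comm Q Q']
    abel
  | left d s h ih => intro g; simp only [edgeSum_graft]; exact ih _
  | right d t h ih => intro g; simp only [edgeSum_graft, ih]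

end PlanarTree

namespace RTree

variable {D : Type*} {M : Type*} [AddCommMonoid M]

/-- The sum of `g R Q C` over all sets `e` of edges of a rooted tree, see `PlanarTree.edgeSum`. -/
noncomputable def edgeSum (T : RTree D) (g : RTree D → Multiset (RTree D) → RTree D → M) : M :=
  Quot.lift (fun t => PlanarTree.edgeSum t g) (fun _ _ h => h.edgeSum_eq g) T

@[simp] theorem edgeSum_nil (g : RTree D → Multiset (RTree D) → RTree D → M) :
    edgeSum nil g = g nil 0 nil := PlanarTree.edgeSum_nil g

@[simp] theorem edgeSum_graft (d : D) (T S : RTree D)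
    (g : RTree D → Multiset (RTree D) → RTree D → M) :
    edgeSum (graft d T S) g = edgeSum T fun R Q C => edgeSum S fun R' Q' C' =>
      g (graft d R R') (Q + Q') (merge C C') + g R' (R ::ₘ (Q + Q')) (graft d C C') := by
  induction T using Quot.ind
  induction S using Quot.ind
  exact PlanarTree.edgeSum_graft _ _ _ _

theorem edgeSum_comm (T S : RTree D)
    (g : RTree D → Multiset (RTree D) → RTree D → RTree D → Multiset (RTree D) → RTree D → M) :
    (edgeSum T fun R Q C => edgeSum S fun R' Q' C' => g R Q C R' Q' C') =
      edgeSum S fun R' Q' C' => edgeSum T fun R Q C => g R Q C R' Q' C' := by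
  induction T using Quot.ind
  induction S using Quot.ind
  exact PlanarTree.edgeSum_comm _ _ _

theorem edgeSum_comm_comm (T S : RTree D)
    (p p' : RTree D → Multiset (RTree D) → RTree D → RTree D)
    (g : RTree D → Multiset (RTree D) → RTree D → RTree D → Multiset (RTree D) → RTree D →
      RTree D → Multiset (RTree D) → RTree D → RTree D → Multiset (RTree D) → RTree D → M) :
    (T.edgeSum fun R Q C => (p R Q C).edgeSum fun R₁ Q₁ C₁ =>
      S.edgeSum fun R' Q' C' => (p' R' Q' C').edgeSum fun R₁' Q₁' C₁' =>
        g R Q C R₁ Q₁ C₁ R' Q' C' R₁' Q₁' C₁') =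
    S.edgeSum fun R' Q' C' => (p' R' Q' C').edgeSum fun R₁' Q₁' C₁' =>
      T.edgeSum fun R Q C => (p R Q C).edgeSum fun R₁ Q₁ C₁ =>
        g R Q C R₁ Q₁ C₁ R' Q' C' R₁' Q₁' C₁' := by
  calc
    _ = T.edgeSum fun R Q C => S.edgeSum fun R' Q' C' => (p' R' Q' C').edgeSum fun R₁' Q₁' C₁' =>
          (p R Q C).edgeSum fun R₁ Q₁ C₁ => g R Q C R₁ Q₁ C₁ R' Q' C' R₁' Q₁' C₁' := by
      congr 1; ext R Q C
      rw [edgeSum_comm (p R Q C) S]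
      congr 1; ext R' Q' C'
      rw [edgeSum_comm]
    _ = _ := by
      rw [edgeSum_comm T S]
      congr 1; ext R' Q' C'
      rw [edgeSum_comm]

theorem map_edgeSum {N F : Type*} [AddCommMonoid N] [FunLike F M N] [AddMonoidHomClass F M N]
    (f : F) (T : RTree D) (g : RTree D → Multiset (RTree D) → RTree D → M) :
    f (edgeSum T g) = edgeSum T fun R Q C => f (g R Q C) := by
  induction T using Quot.ind
  exact map_sum f _ _

theorem edgeSum_add (T : RTree D) (g h : RTree D → Multiset (RTree D) → RTree D → M) :
    (edgeSum T fun R Q C => g R Q C + h R Q C) = edgeSum T g + edgeSum T h := by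
  induction T using Quot.ind
  exact Finset.sum_add_distrib

@[simp] theorem edgeSum_zero (T : RTree D) :
    (edgeSum T fun _ _ _ => (0 : M)) = 0 := by
  induction T using Quot.ind
  exact Finset.sum_const_zero

theorem edgeSum_merge (T S : RTree D) (g : RTree D → Multiset (RTree D) → RTree D → M) :
    edgeSum (merge T S) g = edgeSum T fun R Q C => edgeSum S fun R' Q' C' =>
      g (merge R R') (Q + Q') (merge C C') := by
  induction T using ind generalizing g with
  | hn => simp
  | hg d T T' _ ih =>
    simp only [graft_merge, edgeSum_graft, ih, edgeSum_add, merge_assoc, add_assoc,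
      Multiset.cons_add]

end RTree

/-- Trees with at least one edge, with edges decorated by `D`. -/
structure NTree (D : Type*) where
  tree : RTree D
  ne_nil : tree ≠ RTree.nil

/-- The algebra of contractions: the vector space spanned by the rooted forests with edges
decorated by `D`, with concatenation as product, where the single vertex is identified with
the unit. So it is the polynomial algebra on the trees with at least one edge; its monomials are
the forests. -/
def CCK (K : Type*) [Field K] (D : Type*) : Type _ := MvPolynomial (NTree D) K

namespace CCK

variable {K : Type*} [Field K] {D : Type*}

noncomputable instance : CommRing (CCK K D) := inferInstanceAs (CommRing (MvPolynomial (NTree D) K))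

noncomputable instance : Algebra K (CCK K D) :=
  inferInstanceAs (Algebra K (MvPolynomial (NTree D) K))

/-- A tree with at least one edge, as an element of the algebra. -/
noncomputable def X (T : NTree D) : CCK K D := (MvPolynomial.X T : MvPolynomial (NTree D) K)

open Classical in
/-- A tree as an element of the algebra. The single vertex is the unit. -/
noncomputable def ofTree (T : RTree D) : CCK K D := if h : T = RTree.nil then 1 else X ⟨T, h⟩

/-- A forest as an element of the algebra: the product of its trees. -/
noncomputable def ofForest (F : Multiset (RTree D)) : CCK K D := (F.map ofTree).prod

@[simp] theorem ofTree_nil : (ofTree RTree.nil : CCK K D) = 1 := dif_pos rfl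

theorem ofTree_coe (T : NTree D) : (ofTree T.tree : CCK K D) = X T := dif_neg T.ne_nil

@[simp] theorem ofForest_zero : (ofForest 0 : CCK K D) = 1 := by simp [ofForest]

@[simp] theorem ofForest_add (F G : Multiset (RTree D)) :
    (ofForest (F + G) : CCK K D) = ofForest F * ofForest G := by simp [ofForest]

@[simp] theorem ofForest_cons (T : RTree D) (G : Multiset (RTree D)) :
    (ofForest (T ::ₘ G) : CCK K D) = ofTree T * ofForest G := by simp [ofForest]

/-- Algebra morphisms out of the algebra of contractions are given by their values on trees. -/
noncomputable def lift {A : Type*} [CommRing A] [Algebra K A] (f : NTree D → A) :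
    CCK K D →ₐ[K] A :=
  (MvPolynomial.aeval f : MvPolynomial (NTree D) K →ₐ[K] A)

@[simp] theorem lift_X {A : Type*} [CommRing A] [Algebra K A] (f : NTree D → A) (T : NTree D) :
    lift f (X T : CCK K D) = f T := MvPolynomial.aeval_X f T

theorem algHom_ext {A : Type*} [Semiring A] [Algebra K A] {f g : CCK K D →ₐ[K] A}
    (h : ∀ T, f (X T) = g (X T)) : f = g :=
  MvPolynomial.algHom_ext (A := A) (f := f) (g := g) h

theorem induction_on {P : CCK K D → Prop} (x : CCK K D) (hC : ∀ a : K, P (algebraMap K _ a))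
    (hadd : ∀ p q, P p → P q → P (p + q)) (hX : ∀ p T, P p → P (p * X T)) : P x :=
  MvPolynomial.induction_on (motive := P) x hC hadd hX

/-- The contraction coproduct of a planar tree `t`:
the sum of `Part_e(t) ⊗ Cont_e(t)` over all sets `e` of edges of `t`. -/
noncomputable def comulPlanar (t : PlanarTree D) : CCK K D ⊗[K] CCK K D :=
  ∑ e : Set (PlanarTree.Edge t),
    ofForest ((PlanarTree.part t e).map RTree.mk) ⊗ₜ[K] ofTree (RTree.mk (PlanarTree.cont t e))

theorem comulPlanar_eq (t : PlanarTree D) :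
    (comulPlanar t : CCK K D ⊗[K] CCK K D) =
      PlanarTree.edgeSum t fun R Q C => (ofTree R * ofForest Q) ⊗ₜ[K] ofTree C := by
  simp only [comulPlanar, PlanarTree.part, Multiset.map_cons, ofForest_cons, PlanarTree.edgeSum]

/-- The contraction coproduct of a tree. It does not depend on the planar representative. -/
noncomputable def comulTree : RTree D → CCK K D ⊗[K] CCK K D :=
  Quot.lift comulPlanar fun _ _ h => by rw [comulPlanar_eq, comulPlanar_eq, h.edgeSum_eq]

theorem comulTree_eq (T : RTree D) :
    (comulTree T : CCK K D ⊗[K] CCK K D) =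
      T.edgeSum fun R Q C => (ofTree R * ofForest Q) ⊗ₜ[K] ofTree C := by
  induction T using Quot.ind
  exact comulPlanar_eq _

/-- The contraction coproduct, extended multiplicatively from trees to forests. -/
noncomputable def comulHom : CCK K D →ₐ[K] CCK K D ⊗[K] CCK K D := lift fun T => comulTree T.tree

/-- The counit: the empty forest (the single vertex) is sent to `1`, other forests to `0`. -/
noncomputable def counitHom : CCK K D →ₐ[K] K := lift fun _ => 0

theorem comulHom_ofTree (T : RTree D) :
    comulHom (ofTree T : CCK K D) =
      T.edgeSum fun R Q C => (ofTree R * ofForest Q) ⊗ₜ[K] ofTree C := by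
  rw [← comulTree_eq]
  by_cases h : T = RTree.nil
  · subst h
    rw [ofTree_nil, map_one, comulTree_eq]
    simp [Algebra.TensorProduct.one_def]
  · rw [ofTree_coe ⟨T, h⟩, comulHom, lift_X]

theorem counitHom_ofTree_graft (d : D) (T S : RTree D) :
    counitHom (ofTree (RTree.graft d T S) : CCK K D) = 0 := by
  rw [ofTree_coe ⟨_, RTree.graft_ne_nil d T S⟩, counitHom, lift_X]

theorem counitHom_ofTree_merge (T S : RTree D) :
    counitHom (ofTree (RTree.merge T S) : CCK K D) =
      counitHom (ofTree T : CCK K D) * counitHom (ofTree S : CCK K D) := by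
  induction T using RTree.ind with
  | hn => simp
  | hg d T T' _ _ => simp [counitHom_ofTree_graft]

theorem edgeSum_coassoc {M : Type*} [AddCommMonoid M] (T : RTree D) :
    ∀ G : RTree D → RTree D → RTree D → (CCK K D ⊗[K] CCK K D →+ M),
    (T.edgeSum fun R Q C => R.edgeSum fun R₁ Q₁ C₁ =>
      G R₁ C₁ C ((ofForest Q₁ ⊗ₜ 1) * comulHom (ofForest Q : CCK K D))) =
    T.edgeSum fun R₁ Q₁ C₁ => C₁.edgeSum fun R₂ Q₂ C₂ =>
      G R₁ R₂ C₂ (ofForest Q₁ ⊗ₜ ofForest Q₂) := by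
  induction T using RTree.ind with
  | hn => intro G; simp
  | hg d T S ihT ihS =>
    intro G
    set H : RTree D → RTree D → RTree D → CCK K D ⊗[K] CCK K D → RTree D → RTree D → RTree D →
        CCK K D ⊗[K] CCK K D → M := fun r k c z r' k' c' z' =>
      G (RTree.graft d r r') (RTree.merge k k') (RTree.merge c c') (z * z') +
      G r' (RTree.graft d k k') (RTree.merge c c') ((ofTree r ⊗ₜ 1) * z * z') +
      G r' k' (RTree.graft d c c') ((ofTree r ⊗ₜ ofTree k) * z * z') with hH
    set H₁ : RTree D → RTree D → RTree D → CCK K D ⊗[K] CCK K D → RTree D → RTree D → RTree D →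
        (CCK K D ⊗[K] CCK K D →+ M) := fun r k c z r' k' c' =>
      (G (RTree.graft d r r') (RTree.merge k k') (RTree.merge c c')).comp (AddMonoidHom.mulLeft z) +
      (G r' (RTree.graft d k k') (RTree.merge c c')).comp
        (AddMonoidHom.mulLeft ((ofTree r ⊗ₜ 1) * z)) +
      (G r' k' (RTree.graft d c c')).comp
        (AddMonoidHom.mulLeft ((ofTree r ⊗ₜ ofTree k) * z)) with hH₁
    set H₂ : RTree D → RTree D → RTree D → CCK K D ⊗[K] CCK K D → RTree D → RTree D → RTree D →
        (CCK K D ⊗[K] CCK K D →+ M) := fun r' k' c' z' r k c =>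
      (G (RTree.graft d r r') (RTree.merge k k') (RTree.merge c c')).comp (AddMonoidHom.mulRight z') +
      (G r' (RTree.graft d k k') (RTree.merge c c')).comp
        ((AddMonoidHom.mulRight z').comp (AddMonoidHom.mulLeft (ofTree r ⊗ₜ 1))) +
      (G r' k' (RTree.graft d c c')).comp
        ((AddMonoidHom.mulRight z').comp (AddMonoidHom.mulLeft (ofTree r ⊗ₜ ofTree k))) with hH₂
    have e₁ : ∀ r k c z r' k' c' z', H r k c z r' k' c' z' = H₁ r k c z r' k' c' z' := by
      intros; simp [hH, hH₁]
    have e₂ : ∀ r k c z r' k' c' z', H r k c z r' k' c' z' = H₂ r' k' c' z' r k c z := by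
      intros; simp [hH, hH₂]
    have lhs : ((RTree.graft d T S).edgeSum fun R Q C => R.edgeSum fun R₁ Q₁ C₁ =>
          G R₁ C₁ C ((ofForest Q₁ ⊗ₜ 1) * comulHom (ofForest Q : CCK K D))) =
        T.edgeSum fun R Q C => R.edgeSum fun R₁ Q₁ C₁ =>
        S.edgeSum fun R' Q' C' => R'.edgeSum fun R₁' Q₁' C₁' =>
          H R₁ C₁ C ((ofForest Q₁ ⊗ₜ 1) * comulHom (ofForest Q))
            R₁' C₁' C' ((ofForest Q₁' ⊗ₜ 1) * comulHom (ofForest Q')) := by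
      rw [RTree.edgeSum_graft]
      congr 1; ext R Q C
      rw [RTree.edgeSum_comm R S]
      congr 1; ext R' Q' C'
      rw [RTree.edgeSum_graft]
      simp only [hH, RTree.edgeSum_add, ofForest_cons, ofForest_add, map_mul, comulHom_ofTree]
      refine (congrArg₂ (· + ·) (congrArg₂ (· + ·) ?_ ?_) ?_)
      · congr 1; ext R₁ Q₁ C₁; congr 1; ext R₁' Q₁' C₁'; congr 1
        rw [show ((ofForest Q₁ * ofForest Q₁' : CCK K D) ⊗ₜ[K] (1 : CCK K D)) =
          (ofForest Q₁ ⊗ₜ 1) * (ofForest Q₁' ⊗ₜ 1) by simp]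
        ring
      · congr 1; ext R₁ Q₁ C₁; congr 1; ext R₁' Q₁' C₁'; congr 1
        rw [show ((ofTree R₁ * (ofForest Q₁ * ofForest Q₁') : CCK K D) ⊗ₜ[K] (1 : CCK K D)) =
          (ofTree R₁ ⊗ₜ 1) * (ofForest Q₁ ⊗ₜ 1) * (ofForest Q₁' ⊗ₜ 1) by simp [mul_assoc]]
        ring
      · rw [RTree.edgeSum_comm R R']
        congr 1; ext R₁' Q₁' C₁'
        have h := RTree.map_edgeSum ((G R₁' C₁' (RTree.graft d C C')).comp
          ((AddMonoidHom.mulLeft (ofForest Q₁' ⊗ₜ 1)).comp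
          (AddMonoidHom.mulRight (comulHom (ofForest Q) * comulHom (ofForest Q' : CCK K D))))) R
          fun R Q C => (ofTree R * ofForest Q) ⊗ₜ[K] (ofTree C : CCK K D)
        simp only [AddMonoidHom.comp_apply, AddMonoidHom.coe_mulLeft,
          AddMonoidHom.coe_mulRight] at h
        rw [h]
        congr 1; ext R₁ Q₁ C₁; congr 1
        rw [show ((ofTree R₁ * ofForest Q₁ : CCK K D) ⊗ₜ[K] (ofTree C₁ : CCK K D)) =
          (ofTree R₁ ⊗ₜ ofTree C₁) * (ofForest Q₁ ⊗ₜ 1) by simp]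
        ring
    have rhs : ((RTree.graft d T S).edgeSum fun R₁ Q₁ C₁ => C₁.edgeSum fun R₂ Q₂ C₂ =>
          G R₁ R₂ C₂ (ofForest Q₁ ⊗ₜ ofForest Q₂)) =
        T.edgeSum fun R₁ Q₁ C₁ => C₁.edgeSum fun R₂ Q₂ C₂ =>
        S.edgeSum fun R₁' Q₁' C₁' => C₁'.edgeSum fun R₂' Q₂' C₂' =>
          H R₁ R₂ C₂ (ofForest Q₁ ⊗ₜ ofForest Q₂)
            R₁' R₂' C₂' (ofForest Q₁' ⊗ₜ ofForest Q₂') := by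
      rw [RTree.edgeSum_graft]
      congr 1; ext R₁ Q₁ C₁
      rw [RTree.edgeSum_comm C₁ S]
      congr 1; ext R₁' Q₁' C₁'
      rw [RTree.edgeSum_graft, RTree.edgeSum_merge]
      simp only [hH, RTree.edgeSum_add, ofForest_cons, ofForest_add, add_assoc]
      refine congrArg₂ (· + ·) ?_ (congrArg₂ (· + ·) ?_ ?_) <;>
      · congr 1; ext R₂ Q₂ C₂; congr 1; ext R₂' Q₂' C₂'; congr 1
        simp [mul_assoc]
    rw [lhs, rhs]
    calc
      _ = T.edgeSum fun R Q C => R.edgeSum fun R₁ Q₁ C₁ =>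
          S.edgeSum fun R₁' Q₁' C₁' => C₁'.edgeSum fun R₂' Q₂' C₂' =>
            H R₁ C₁ C ((ofForest Q₁ ⊗ₜ 1) * comulHom (ofForest Q))
              R₁' R₂' C₂' (ofForest Q₁' ⊗ₜ ofForest Q₂') := by
        simp only [e₁]
        congr 1; ext R Q C; congr 1; ext R₁ Q₁ C₁
        exact ihS (H₁ R₁ C₁ C ((ofForest Q₁ ⊗ₜ 1) * comulHom (ofForest Q)))
      _ = S.edgeSum fun R₁' Q₁' C₁' => C₁'.edgeSum fun R₂' Q₂' C₂' =>
          T.edgeSum fun R Q C => R.edgeSum fun R₁ Q₁ C₁ =>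
            H R₁ C₁ C ((ofForest Q₁ ⊗ₜ 1) * comulHom (ofForest Q))
              R₁' R₂' C₂' (ofForest Q₁' ⊗ₜ ofForest Q₂') :=
        RTree.edgeSum_comm_comm T S (fun R _ _ => R) (fun _ _ C => C) _
      _ = S.edgeSum fun R₁' Q₁' C₁' => C₁'.edgeSum fun R₂' Q₂' C₂' =>
          T.edgeSum fun R₁ Q₁ C₁ => C₁.edgeSum fun R₂ Q₂ C₂ =>
            H R₁ R₂ C₂ (ofForest Q₁ ⊗ₜ ofForest Q₂)
              R₁' R₂' C₂' (ofForest Q₁' ⊗ₜ ofForest Q₂') := by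
        simp only [e₂]
        congr 1; ext R₁' Q₁' C₁'; congr 1; ext R₂' Q₂' C₂'
        exact ihT (H₂ R₁' R₂' C₂' (ofForest Q₁' ⊗ₜ ofForest Q₂'))
      _ = _ := RTree.edgeSum_comm_comm S T (fun _ _ C => C) (fun _ _ C => C) _

theorem edgeSum_counit_left {M : Type*} [AddCommMonoid M] [Module K M] (T : RTree D) :
    ∀ h : RTree D → M,
    (T.edgeSum fun R Q C => counitHom (ofTree R * ofForest Q : CCK K D) • h C) = h T := by
  induction T using RTree.ind with
  | hn => intro h; simp
  | hg d T S ihT ihS =>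
    intro h
    rw [← ihT fun T => h (RTree.graft d T S), RTree.edgeSum_graft]
    congr 1; ext R Q C
    rw [← ihS fun S => h (RTree.graft d C S),
      ← DistribSMul.toAddMonoidHom_apply, RTree.map_edgeSum]
    congr 1; ext R' Q' C'
    simp only [map_mul, counitHom_ofTree_graft, zero_mul, zero_smul, zero_add, ofForest_cons,
      ofForest_add, DistribSMul.toAddMonoidHom_apply, smul_smul]
    congr 1
    ring

theorem edgeSum_counit_right {M : Type*} [AddCommMonoid M] [Module K M] (T : RTree D) :
    ∀ h : RTree D → Multiset (RTree D) → M,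
    (T.edgeSum fun R Q C => counitHom (ofTree C : CCK K D) • h R Q) = h T 0 := by
  induction T using RTree.ind with
  | hn => intro h; simp
  | hg d T S ihT ihS =>
    intro h
    rw [← add_zero (0 : Multiset (RTree D)),
      ← ihT fun T Q => h (RTree.graft d T S) (Q + 0), RTree.edgeSum_graft]
    congr 1; ext R Q C
    rw [← ihS fun S Q' => h (RTree.graft d R S) (Q + Q'),
      ← DistribSMul.toAddMonoidHom_apply, RTree.map_edgeSum]
    congr 1; ext R' Q' C'
    simp only [counitHom_ofTree_graft, counitHom_ofTree_merge, zero_smul, add_zero,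
      DistribSMul.toAddMonoidHom_apply, smul_smul]

theorem comulHom_coassoc (T : RTree D) :
    Algebra.TensorProduct.map comulHom (AlgHom.id K (CCK K D)) (comulHom (ofTree T)) =
      (Algebra.TensorProduct.assoc K K K (CCK K D) (CCK K D) (CCK K D)).symm
        (Algebra.TensorProduct.map (AlgHom.id K (CCK K D)) comulHom (comulHom (ofTree T))) := by
  simp only [comulHom_ofTree, RTree.map_edgeSum, Algebra.TensorProduct.map_tmul, AlgHom.id_apply,
    map_mul]
  have key := edgeSum_coassoc (K := K) T fun R C E =>
    ((TensorProduct.mk K (CCK K D ⊗[K] CCK K D) (CCK K D)).flip (ofTree E)).toAddMonoidHom.comp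
      (AddMonoidHom.mulLeft (ofTree R ⊗ₜ ofTree C))
  simp only [AddMonoidHom.comp_apply, AddMonoidHom.coe_mulLeft, LinearMap.toAddMonoidHom_coe,
    LinearMap.flip_apply, TensorProduct.mk_apply, Algebra.TensorProduct.tmul_mul_tmul] at key
  refine Eq.trans ?_ (key.trans ?_)
  · congr 1; ext R Q C
    have h := RTree.map_edgeSum
      (((TensorProduct.mk K (CCK K D ⊗[K] CCK K D) (CCK K D)).flip (ofTree C)).toAddMonoidHom.comp
        (AddMonoidHom.mulRight (comulHom (ofForest Q)))) R
        fun R Q C => (ofTree R * ofForest Q) ⊗ₜ[K] (ofTree C : CCK K D)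
    simp only [AddMonoidHom.comp_apply, AddMonoidHom.coe_mulRight, LinearMap.toAddMonoidHom_coe,
      LinearMap.flip_apply, TensorProduct.mk_apply] at h
    rw [h]
    congr 1; ext R₁ Q₁ C₁
    rw [← mul_assoc, Algebra.TensorProduct.tmul_mul_tmul, mul_one]
  · congr 1; ext R Q C
    have h := RTree.map_edgeSum
      ((Algebra.TensorProduct.assoc K K K (CCK K D) (CCK K D) (CCK K D)).symm.toAddMonoidHom.comp
        (TensorProduct.mk K (CCK K D) (CCK K D ⊗[K] CCK K D)
          (ofTree R * ofForest Q)).toAddMonoidHom) C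
        fun R Q C => (ofTree R * ofForest Q) ⊗ₜ[K] (ofTree C : CCK K D)
    simp only [AddMonoidHom.comp_apply, LinearMap.toAddMonoidHom_coe, TensorProduct.mk_apply] at h
    exact h.symm

/-- The contraction coproduct makes the algebra of contractions a bialgebra. -/
noncomputable instance : Bialgebra K (CCK K D) :=
  Bialgebra.ofAlgHom comulHom counitHom
    (algHom_ext fun T => by
      rw [← ofTree_coe]
      exact (AlgEquiv.eq_symm_apply _).1 (comulHom_coassoc T.tree))
    (algHom_ext fun T => by
      rw [← ofTree_coe]
      have h := edgeSum_counit_left (K := K) T.tree fun C => (1 : K) ⊗ₜ[K] (ofTree C : CCK K D)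
      simp only [TensorProduct.smul_tmul', smul_eq_mul, mul_one] at h
      rw [AlgHom.comp_apply, comulHom_ofTree, RTree.map_edgeSum]
      simpa only [Algebra.TensorProduct.map_tmul, AlgHom.id_apply] using! h)
    (algHom_ext fun T => by
      rw [← ofTree_coe]
      have h := edgeSum_counit_right (K := K) T.tree fun R Q =>
        (ofTree R * ofForest Q : CCK K D) ⊗ₜ[K] (1 : K)
      simp only [TensorProduct.smul_tmul', TensorProduct.smul_tmul, smul_eq_mul, mul_one] at h
      rw [AlgHom.comp_apply, comulHom_ofTree, RTree.map_edgeSum]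
      simpa only [Algebra.TensorProduct.map_tmul, AlgHom.id_apply, ofForest_zero,
        mul_one] using! h)

theorem comul_ofTree (t : PlanarTree D) :
    Coalgebra.comul (R := K) (ofTree (RTree.mk t) : CCK K D) =
      ∑ e : Set (PlanarTree.Edge t),
        ofForest ((PlanarTree.part t e).map RTree.mk) ⊗ₜ[K]
          ofTree (RTree.mk (PlanarTree.cont t e)) :=
  (comulHom_ofTree (RTree.mk t)).trans (comulPlanar_eq t).symm

end CCK

/-- In a bialgebra `A` with subspaces `F 0, F 1, …` covering `A` such that `Δ x - 1 ⊗ x` is, for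
`x ∈ F n`, a sum of tensors `a ⊗ y` with `y ∈ F m` for some `m < n`, every linear endomorphism
fixing `1` has a right convolution inverse fixing `1`. -/
theorem exists_convMul_eq_one {K A : Type*} [Field K] [Ring A] [Bialgebra K A]
    (F : ℕ → Submodule K A) (hF : ∀ x, ∃ n, x ∈ F n)
    (hΔ : ∀ n, ∀ x ∈ F n, Coalgebra.comul (R := K) x - 1 ⊗ₜ[K] x ∈
      Submodule.span K {z : A ⊗[K] A | ∃ a, ∃ m < n, ∃ y ∈ F m, z = a ⊗ₜ[K] y})
    (u : WithConv (A →ₗ[K] A)) (hu : u.ofConv 1 = 1) :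
    ∃ v : WithConv (A →ₗ[K] A), u * v = 1 ∧ v.ofConv 1 = 1 := by
  set f : WithConv (A →ₗ[K] A) := 1 - u with hf
  have hf1 : f.ofConv 1 = 0 := by
    have : (1 : WithConv (A →ₗ[K] A)).ofConv 1 = 1 := by simp
    rw [hf, WithConv.ofConv_sub, LinearMap.sub_apply, this, hu, sub_self]
  have key : ∀ (g : WithConv (A →ₗ[K] A)) (n : ℕ) (x : A), x ∈ F n →
      (∀ m < n, ∀ y ∈ F m, g.ofConv y = 0) → (f * g).ofConv x = 0 := by
    intro g n x hx hg
    have h2 : ∀ z ∈ Submodule.span K {z : A ⊗[K] A | ∃ a, ∃ m < n, ∃ y ∈ F m, z = a ⊗ₜ[K] y},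
        LinearMap.mul' K A (TensorProduct.map f.ofConv g.ofConv z) = 0 := by
      intro z hz
      induction hz using Submodule.span_induction with
      | mem z hz =>
        obtain ⟨a, m, hm, y, hy, rfl⟩ := hz
        simp [hg m hm y hy]
      | zero => simp
      | add x y _ _ hx hy => rw [map_add, map_add, hx, hy, add_zero]
      | smul a x _ hx => rw [map_smul, map_smul, hx, smul_zero]
    have h3 := h2 _ (hΔ n x hx)
    rw [map_sub, map_sub, TensorProduct.map_tmul, hf1, TensorProduct.zero_tmul, map_zero,
      sub_zero] at h3
    exact h3
  have van : ∀ i n x, x ∈ F n → n < i → (f ^ i).ofConv x = 0 := by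
    intro i
    induction i with
    | zero => intro n x _ h; omega
    | succ i ih =>
      intro n x hx hn
      rw [pow_succ']
      exact key _ n x hx fun m hm y hy => ih m y hy (by omega)
  have hfin : ∀ x, (Function.support fun i => (f ^ i).ofConv x).Finite := by
    intro x
    obtain ⟨n, hn⟩ := hF x
    refine (Set.finite_Iic n).subset fun i hi => ?_
    by_contra h
    exact hi (van i n x hn (by simpa using h))
  let S : A →ₗ[K] A :=
    { toFun := fun x => ∑ᶠ i, (f ^ i).ofConv x
      map_add' := fun x y => by
        simp only [map_add]
        exact finsum_add_distrib (hfin x) (hfin y)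
      map_smul' := fun c x => by
        simp only [map_smul, RingHom.id_apply]
        exact (smul_finsum' c (hfin x)).symm }
  have hS : ∀ n x, x ∈ F n → ∀ N, n < N → S x = ∑ i ∈ Finset.range N, (f ^ i).ofConv x := by
    intro n x hx N hN
    refine finsum_eq_sum_of_support_subset _ fun i hi => ?_
    simp only [Finset.coe_range, Set.mem_Iio]
    by_contra h
    exact hi (van i n x hx (by omega))
  have hsum : ∀ (N : ℕ) (x : A), (∑ i ∈ Finset.range N, f ^ i : WithConv (A →ₗ[K] A)).ofConv x =
      ∑ i ∈ Finset.range N, (f ^ i).ofConv x := by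
    intro N x
    induction N with
    | zero => simp
    | succ N ih => rw [Finset.sum_range_succ, Finset.sum_range_succ, ← ih]; rfl
  have hrec : WithConv.toConv S = 1 + f * WithConv.toConv S := by
    refine WithConv.ext (LinearMap.ext fun x => ?_)
    obtain ⟨n, hn⟩ := hF x
    have h1 : (f * (WithConv.toConv S - ∑ i ∈ Finset.range n, f ^ i)).ofConv x = 0 := by
      refine key _ n x hn fun m hm y hy => ?_
      rw [WithConv.ofConv_sub, LinearMap.sub_apply, hsum, ← hS m y hy n hm]
      exact sub_self _
    rw [mul_sub, WithConv.ofConv_sub, LinearMap.sub_apply, sub_eq_zero] at h1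
    change S x = (1 : WithConv (A →ₗ[K] A)).ofConv x + (f * WithConv.toConv S).ofConv x
    rw [h1, hS n x hn (n + 1) (by omega), Finset.sum_range_succ', Finset.mul_sum, pow_zero,
      add_comm]
    simp only [← pow_succ']
    congr 1
    have : ∀ N : ℕ, (∑ i ∈ Finset.range N, f ^ (i + 1) : WithConv (A →ₗ[K] A)).ofConv x =
      ∑ i ∈ Finset.range N, (f ^ (i + 1)).ofConv x := by
      intro N
      induction N with
      | zero => simp
      | succ N ih => rw [Finset.sum_range_succ, Finset.sum_range_succ, ← ih]; rfl
    exact (this n).symm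
  refine ⟨WithConv.toConv S, ?_, ?_⟩
  · have hu' : u = 1 - f := by rw [hf]; abel
    rw [hu', sub_mul, one_mul, sub_eq_iff_eq_add]
    exact hrec
  · have h := congrArg (fun v : WithConv (A →ₗ[K] A) => v.ofConv 1) hrec
    have h0 : (f * WithConv.toConv S).ofConv 1 = 0 := by
      change LinearMap.mul' K A (TensorProduct.map f.ofConv S (Coalgebra.comul (R := K) 1)) = 0
      rw [Bialgebra.comul_one, Algebra.TensorProduct.one_def, TensorProduct.map_tmul, hf1]
      simp
    have h1 : (1 : WithConv (A →ₗ[K] A)).ofConv 1 = 1 := by simp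
    refine h.trans ?_
    change (1 : WithConv (A →ₗ[K] A)).ofConv 1 + (f * WithConv.toConv S).ofConv 1 = 1
    rw [h0, h1, add_zero]

/-- Under the assumptions of `exists_convMul_eq_one`, the identity has a two-sided convolution
inverse. -/
theorem exists_antipode {K A : Type*} [Field K] [Ring A] [Bialgebra K A]
    (F : ℕ → Submodule K A) (hF : ∀ x, ∃ n, x ∈ F n)
    (hΔ : ∀ n, ∀ x ∈ F n, Coalgebra.comul (R := K) x - 1 ⊗ₜ[K] x ∈
      Submodule.span K {z : A ⊗[K] A | ∃ a, ∃ m < n, ∃ y ∈ F m, z = a ⊗ₜ[K] y}) :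
    ∃ S : A →ₗ[K] A, WithConv.toConv S * WithConv.toConv LinearMap.id = 1 ∧
      WithConv.toConv LinearMap.id * WithConv.toConv S = 1 := by
  obtain ⟨v, hv, hv1⟩ := exists_convMul_eq_one F hF hΔ (WithConv.toConv LinearMap.id) rfl
  obtain ⟨w, hw, _⟩ := exists_convMul_eq_one F hF hΔ v hv1
  have : WithConv.toConv LinearMap.id = w := by
    rw [← mul_one (WithConv.toConv LinearMap.id), ← hw, ← mul_assoc, hv, one_mul]
  exact ⟨v.ofConv, by rw [this]; exact hw, hv⟩

namespace PlanarTree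

variable {D : Type*}

@[simp] theorem numEdges_merge (t s : PlanarTree D) :
    numEdges (merge t s) = numEdges t + numEdges s := by
  induction t with
  | nil => simp [merge, numEdges]
  | graft d t u _ ih => simp only [merge, numEdges, ih]; omega

theorem numEdges_cont_le (t : PlanarTree D) (e : Set (Edge t)) :
    numEdges (cont t e) ≤ numEdges t := by
  induction t with
  | nil => exact le_rfl
  | graft d t s iht ihs =>
    have h1 := iht (Edge.onLeft e)
    have h2 := ihs (Edge.onRight e)
    rw [cont]
    split_ifs
    · rw [numEdges_merge, numEdges]; omega
    · simp only [numEdges]; omega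

theorem numEdges_cont_lt (t : PlanarTree D) (e : Set (Edge t)) (he : e ≠ ∅) :
    numEdges (cont t e) < numEdges t := by
  induction t with
  | nil =>
    obtain ⟨x, _⟩ := Set.nonempty_iff_ne_empty.2 he
    exact (show Empty from x).elim
  | graft d t s iht ihs =>
    have h1 := numEdges_cont_le t (Edge.onLeft e)
    have h2 := numEdges_cont_le s (Edge.onRight e)
    rw [cont]
    split_ifs with h
    · rw [numEdges_merge, numEdges]; omega
    · simp only [numEdges]
      by_cases hl : Edge.onLeft e = ∅
      · have hr : Edge.onRight e ≠ ∅ := by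
          intro hr
          refine he (Set.eq_empty_iff_forall_notMem.2 fun x hx => ?_)
          change Option (Edge t ⊕ Edge s) at x
          rcases x with _ | x | x
          · exact h hx
          · exact Set.eq_empty_iff_forall_notMem.1 hl x hx
          · exact Set.eq_empty_iff_forall_notMem.1 hr x hx
        have := ihs _ hr
        omega
      · have := iht _ hl
        omega

theorem cont_empty (t : PlanarTree D) : cont t ∅ = t := by
  induction t with
  | nil => rfl
  | graft d t s iht ihs =>
    rw [cont, if_neg (Set.notMem_empty _)]
    exact congrArg₂ (graft d) iht ihs

theorem rootPart_empty (t : PlanarTree D) : rootPart t ∅ = nil := by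
  induction t with
  | nil => rfl
  | graft d t s iht ihs =>
    rw [rootPart, if_neg (Set.notMem_empty _)]
    exact ihs

theorem otherParts_empty (t : PlanarTree D) : ∀ s ∈ otherParts t ∅, s = nil := by
  induction t with
  | nil => intro s hs; exact absurd hs (Multiset.notMem_zero s)
  | graft d t s iht ihs =>
    intro r hr
    rw [otherParts, if_neg (Set.notMem_empty _)] at hr
    rcases Multiset.mem_cons.1 hr with h | h
    · rw [h]; exact rootPart_empty t
    · rcases Multiset.mem_add.1 h with h | h
      · exact iht r h
      · exact ihs r h

end PlanarTree

namespace CCK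

variable {K : Type*} [Field K] {D : Type*}

/-- The span of the forests with at most `n` edges. -/
noncomputable def filtration (K : Type*) [Field K] (D : Type*) (n : ℕ) : Submodule K (CCK K D) :=
  Submodule.span K {x | ∃ F : Multiset (RTree D), (F.map RTree.numEdges).sum ≤ n ∧ x = ofForest F}

/-- The span of the tensors whose right factor is a forest with less than `n` edges. -/
noncomputable def lower (K : Type*) [Field K] (D : Type*) (n : ℕ) :
    Submodule K (CCK K D ⊗[K] CCK K D) :=
  Submodule.span K {z | ∃ a, ∃ m < n, ∃ y ∈ filtration K D m, z = a ⊗ₜ[K] y}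

theorem filtration_mul {a b : ℕ} {x y : CCK K D} (hx : x ∈ filtration K D a)
    (hy : y ∈ filtration K D b) : x * y ∈ filtration K D (a + b) := by
  have h := Submodule.mul_mem_mul hx hy
  rw [filtration, filtration, Submodule.span_mul_span] at h
  refine Submodule.span_mono ?_ h
  rintro _ ⟨_, ⟨F, hF, rfl⟩, _, ⟨G, hG, rfl⟩, rfl⟩
  exact ⟨F + G, by rw [Multiset.map_add, Multiset.sum_add]; omega, (ofForest_add F G).symm⟩

theorem ofForest_mem (F : Multiset (RTree D)) :
    (ofForest F : CCK K D) ∈ filtration K D (F.map RTree.numEdges).sum :=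
  Submodule.subset_span ⟨F, le_rfl, rfl⟩

theorem filtration_mono {a b : ℕ} (h : a ≤ b) : filtration K D a ≤ filtration K D b :=
  Submodule.span_mono fun _ ⟨F, hF, hx⟩ => ⟨F, hF.trans h, hx⟩

theorem lower_mono {a b : ℕ} (h : a ≤ b) : lower K D a ≤ lower K D b :=
  Submodule.span_mono fun _ ⟨x, m, hm, y, hy, hz⟩ => ⟨x, m, by omega, y, hy, hz⟩

theorem tmul_mem_lower {m n : ℕ} (h : m < n) (a : CCK K D) {y : CCK K D}
    (hy : y ∈ filtration K D m) : a ⊗ₜ[K] y ∈ lower K D n :=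
  Submodule.subset_span ⟨a, m, h, y, hy, rfl⟩

theorem lower_mul {a b : ℕ} {x : CCK K D ⊗[K] CCK K D} {y : CCK K D} (hx : x ∈ lower K D a)
    (c : CCK K D) (hy : y ∈ filtration K D b) : x * (c ⊗ₜ y) ∈ lower K D (a + b) := by
  induction hx using Submodule.span_induction with
  | mem z hz =>
    obtain ⟨d, m, hm, w, hw, rfl⟩ := hz
    rw [Algebra.TensorProduct.tmul_mul_tmul]
    exact Submodule.subset_span ⟨_, m + b, by omega, _, filtration_mul hw hy, rfl⟩
  | zero => simp
  | add x y _ _ hx hy => rw [add_mul]; exact add_mem hx hy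
  | smul a x _ hx => rw [smul_mul_assoc]; exact Submodule.smul_mem _ _ hx

theorem lower_mul_lower {a b : ℕ} {x y : CCK K D ⊗[K] CCK K D} (hx : x ∈ lower K D a)
    (hy : y ∈ lower K D b) : x * y ∈ lower K D (a + b) := by
  induction hy using Submodule.span_induction with
  | mem z hz =>
    obtain ⟨d, m, hm, w, hw, rfl⟩ := hz
    exact lower_mono (by omega) (lower_mul hx d hw)
  | zero => simp
  | add x y _ _ hx hy => rw [mul_add]; exact add_mem hx hy
  | smul a x _ hx => rw [mul_smul_comm]; exact Submodule.smul_mem _ _ hx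

theorem ofTree_mem (T : RTree D) : (ofTree T : CCK K D) ∈ filtration K D T.numEdges := by
  have h := ofForest_mem (K := K) {T}
  rwa [Multiset.map_singleton, Multiset.sum_singleton, ofForest, Multiset.map_singleton,
    Multiset.prod_singleton] at h

theorem comul_ofTree_sub (T : RTree D) :
    Coalgebra.comul (R := K) (ofTree T : CCK K D) - 1 ⊗ₜ[K] ofTree T ∈ lower K D T.numEdges := by
  induction T using Quot.ind with
  | mk t =>
    change Coalgebra.comul (R := K) (ofTree (RTree.mk t) : CCK K D) - 1 ⊗ₜ[K] ofTree (RTree.mk t)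
      ∈ lower K D t.numEdges
    classical
    rw [comul_ofTree, ← Finset.add_sum_erase _ _ (Finset.mem_univ ∅), PlanarTree.cont_empty]
    have h : (ofForest ((PlanarTree.part t ∅).map RTree.mk) : CCK K D) = 1 := by
      rw [PlanarTree.part, PlanarTree.rootPart_empty, Multiset.map_cons, ofForest_cons]
      refine (congrArg₂ (· * ·) ofTree_nil ?_).trans (one_mul 1)
      rw [ofForest, Multiset.map_map]
      refine Multiset.prod_eq_one fun x hx => ?_
      obtain ⟨s, hs, rfl⟩ := Multiset.mem_map.1 hx
      rw [PlanarTree.otherParts_empty t s hs]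
      exact ofTree_nil
    rw [h, add_sub_cancel_left]
    refine Submodule.sum_mem _ fun e he => ?_
    have hlt := PlanarTree.numEdges_cont_lt t e (Finset.ne_of_mem_erase he)
    rw [← RTree.numEdges_mk] at hlt
    exact tmul_mem_lower hlt _ (ofTree_mem _)

theorem tensor_identity (a b c d : CCK K D ⊗[K] CCK K D) :
    a * b - c * d = (a - c) * d + (b - d) * c + (a - c) * (b - d) := by ring

theorem comul_mul_sub {m n : ℕ} {x y : CCK K D}
    (hx : Coalgebra.comul (R := K) x - 1 ⊗ₜ[K] x ∈ lower K D m)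
    (hy : Coalgebra.comul (R := K) y - 1 ⊗ₜ[K] y ∈ lower K D n)
    (hx' : x ∈ filtration K D m) (hy' : y ∈ filtration K D n) :
    Coalgebra.comul (R := K) (x * y) - 1 ⊗ₜ[K] (x * y) ∈ lower K D (m + n) := by
  have h1 := lower_mul hx 1 hy'
  have h2 := lower_mul hy 1 hx'
  have h3 := lower_mul_lower hx hy
  rw [add_comm n m] at h2
  have h4 : (1 : CCK K D) ⊗ₜ[K] (x * y) = 1 ⊗ₜ[K] x * 1 ⊗ₜ[K] y := by
    rw [Algebra.TensorProduct.tmul_mul_tmul, one_mul]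
  rw [Bialgebra.comul_mul, h4, tensor_identity]
  exact add_mem (add_mem h1 h2) h3

theorem comul_ofForest_sub (F : Multiset (RTree D)) :
    Coalgebra.comul (R := K) (ofForest F : CCK K D) - 1 ⊗ₜ[K] ofForest F ∈
      lower K D (F.map RTree.numEdges).sum := by
  induction F using Multiset.induction_on with
  | empty =>
    rw [ofForest_zero, Bialgebra.comul_one, Algebra.TensorProduct.one_def, sub_self]
    exact zero_mem _
  | cons T F ih =>
    rw [ofForest_cons, Multiset.map_cons, Multiset.sum_cons]
    exact comul_mul_sub (comul_ofTree_sub T) ih (ofTree_mem T) (ofForest_mem F)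

theorem exists_mem_filtration (x : CCK K D) : ∃ n, x ∈ filtration K D n := by
  induction x using induction_on with
  | hC a =>
    refine ⟨0, ?_⟩
    rw [Algebra.algebraMap_eq_smul_one]
    exact Submodule.smul_mem _ _ (Submodule.subset_span ⟨0, by simp, by simp⟩)
  | hadd p q hp hq =>
    obtain ⟨a, ha⟩ := hp
    obtain ⟨b, hb⟩ := hq
    exact ⟨max a b, add_mem (filtration_mono (le_max_left a b) ha)
      (filtration_mono (le_max_right a b) hb)⟩
  | hX p T hp =>
    obtain ⟨a, ha⟩ := hp
    rw [← ofTree_coe]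
    exact ⟨_, filtration_mul ha (ofTree_mem _)⟩

theorem exists_antipode : ∃ S : CCK K D →ₗ[K] CCK K D,
    WithConv.toConv S * WithConv.toConv LinearMap.id = 1 ∧
      WithConv.toConv LinearMap.id * WithConv.toConv S = 1 := by
  refine _root_.exists_antipode (filtration K D) exists_mem_filtration fun n x hx => ?_
  change _ ∈ lower K D n
  induction hx using Submodule.span_induction with
  | mem x hx =>
    obtain ⟨F, hF, rfl⟩ := hx
    exact lower_mono hF (comul_ofForest_sub F)
  | zero => simp
  | add x y _ _ hx hy =>
    rw [map_add, TensorProduct.tmul_add, add_sub_add_comm]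
    exact add_mem hx hy
  | smul a x _ hx =>
    rw [map_smul, TensorProduct.tmul_smul, ← smul_sub]
    exact Submodule.smul_mem _ _ hx

/-- The Hopf algebra of contractions. -/
noncomputable instance : HopfAlgebra K (CCK K D) :=
  HopfAlgebra.ofConvInverse exists_antipode.choose exists_antipode.choose_spec.1
    exists_antipode.choose_spec.2

end CCK

/-- A commutative and associative product on `D` with values in `D ∪ {0}`, where `none` stands
for `0`. -/
class IsCommAssocBracket {D : Type*} (m : D → D → Option D) : Prop where
  comm : ∀ a b, m a b = m b a
  assoc : ∀ a b c, (m a b).bind (fun x => m x c) = (m b c).bind (fun y => m a y)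

/-- The vector space spanned by the words in the alphabet `D`. It is given below the quasi-shuffle
product for the bracket `m`, and the deconcatenation coproduct. -/
def QuasiShuffle (K : Type*) [Field K] {D : Type*} (_m : D → D → Option D) : Type _ := List D →₀ K

namespace QuasiShuffle

variable {K : Type*} [Field K] {D : Type*} {m : D → D → Option D}

noncomputable instance : AddCommGroup (QuasiShuffle K m) :=
  inferInstanceAs (AddCommGroup (List D →₀ K))

noncomputable instance : Module K (QuasiShuffle K m) :=
  inferInstanceAs (Module K (List D →₀ K))

/-- A word, as a basis vector. -/
noncomputable def word (w : List D) : QuasiShuffle K m := (Finsupp.single w 1 : List D →₀ K)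

/-- The linear map with prescribed values on words. -/
noncomputable def lift {M : Type*} [AddCommGroup M] [Module K M] (f : List D → M) :
    QuasiShuffle K m →ₗ[K] M :=
  (Finsupp.linearCombination K f : (List D →₀ K) →ₗ[K] M)

@[simp] theorem lift_word {M : Type*} [AddCommGroup M] [Module K M] (f : List D → M)
    (w : List D) : lift f (word w : QuasiShuffle K m) = f w := by
  refine (Finsupp.linearCombination_single K (1 : K) w).trans ?_
  rw [one_smul]

theorem lin_ext {M : Type*} [AddCommGroup M] [Module K M] {f g : QuasiShuffle K m →ₗ[K] M}
    (h : ∀ w, f (word w) = g (word w)) : f = g :=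
  Finsupp.lhom_ext' (φ := f) (ψ := g) fun w => LinearMap.ext_ring (h w)

/-- Adding a letter at the beginning of words. -/
noncomputable def cons (a : D) : QuasiShuffle K m →ₗ[K] QuasiShuffle K m :=
  lift fun w => word (a :: w)

/-- Adding an element of `D ∪ {0}` at the beginning of words. -/
noncomputable def consOption : Option D → (QuasiShuffle K m →ₗ[K] QuasiShuffle K m)
  | none => 0
  | some a => cons a

/-- The quasi-shuffle product of two words, given by
`au ⧢ bv = a(u ⧢ bv) + b(au ⧢ v) + [ab](u ⧢ v)`, the empty word being the unit. -/
noncomputable def mulWord : List D → List D → QuasiShuffle K m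
  | [], v => word v
  | a :: u, [] => word (a :: u)
  | a :: u, b :: v => cons a (mulWord u (b :: v)) + cons b (mulWord (a :: u) v) +
      consOption (m a b) (mulWord u v)
termination_by u v => u.length + v.length

/-- The quasi-shuffle product, extended bilinearly. -/
noncomputable def mulLin :
    QuasiShuffle K m →ₗ[K] QuasiShuffle K m →ₗ[K] QuasiShuffle K m :=
  lift fun u => lift fun v => mulWord u v

/-- The deconcatenation coproduct. -/
noncomputable def comulLin : QuasiShuffle K m →ₗ[K] QuasiShuffle K m ⊗[K] QuasiShuffle K m :=
  lift fun w => ∑ i ∈ Finset.range (w.length + 1), word (w.take i) ⊗ₜ[K] word (w.drop i)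

/-- The counit: the empty word is sent to `1`, other words to `0`. -/
noncomputable def counitLin : QuasiShuffle K m →ₗ[K] K :=
  lift fun w => if w.isEmpty then 1 else 0

/-- The projection onto the space spanned by the letters: a word of one letter is sent to this
letter, other words to `0`. -/
noncomputable def proj : QuasiShuffle K m →ₗ[K] (D →₀ K) :=
  (Finsupp.lcomapDomain (fun a : D => [a]) (fun _ _ h => List.singleton_injective h) :
    (List D →₀ K) →ₗ[K] (D →₀ K))

@[simp] theorem cons_word (a : D) (w : List D) :
    cons a (word w : QuasiShuffle K m) = word (a :: w) := lift_word _ _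

noncomputable instance : Mul (QuasiShuffle K m) := ⟨fun x y => mulLin x y⟩

noncomputable instance : One (QuasiShuffle K m) := ⟨word []⟩

theorem one_eq : (1 : QuasiShuffle K m) = word [] := rfl

theorem mul_eq (x y : QuasiShuffle K m) : x * y = mulLin x y := rfl

theorem word_mul_word (u v : List D) :
    (word u * word v : QuasiShuffle K m) = mulWord u v := by
  rw [mul_eq, mulLin, lift_word, lift_word]

theorem word_induction {P : QuasiShuffle K m → Prop} (x : QuasiShuffle K m) (h0 : P 0)
    (hadd : ∀ x y, P x → P y → P (x + y)) (hw : ∀ (c : K) w, P (c • word w)) : P x := by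
  refine Finsupp.induction_linear (motive := P) x h0 hadd fun w c => ?_
  have : (Finsupp.single w c : List D →₀ K) = c • Finsupp.single w 1 := by simp
  rw [this]
  exact hw c w

protected theorem one_mul' (x : QuasiShuffle K m) : 1 * x = x := by
  have : (mulLin (word []) : QuasiShuffle K m →ₗ[K] QuasiShuffle K m) = LinearMap.id :=
    lin_ext fun w => by
      rw [← mul_eq, word_mul_word, mulWord, LinearMap.id_apply]
  exact LinearMap.congr_fun this x

protected theorem mul_one' (x : QuasiShuffle K m) : x * 1 = x := by
  have : (mulLin.flip (word []) : QuasiShuffle K m →ₗ[K] QuasiShuffle K m) = LinearMap.id :=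
    lin_ext fun w => by
      rw [LinearMap.flip_apply, ← mul_eq, word_mul_word, LinearMap.id_apply]
      cases w <;> rw [mulWord]
  exact LinearMap.congr_fun this x

theorem cons_mul_cons (a b : D) (x y : QuasiShuffle K m) :
    cons a x * cons b y = cons a (x * cons b y) + cons b (cons a x * y) +
      consOption (m a b) (x * y) := by
  have : mulLin.compl₁₂ (cons a) (cons b) =
      ((mulLin.compl₂ (cons b)).compr₂ (cons a) + (mulLin.comp (cons a)).compr₂ (cons b) +
        mulLin.compr₂ (consOption (m a b)) :
        QuasiShuffle K m →ₗ[K] QuasiShuffle K m →ₗ[K] QuasiShuffle K m) :=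
    lin_ext fun u => lin_ext fun v => by
      simp only [LinearMap.compl₁₂_apply, LinearMap.add_apply, LinearMap.compr₂_apply,
        LinearMap.compl₂_apply, LinearMap.comp_apply, ← mul_eq, cons_word, word_mul_word]
      rw [mulWord]
  exact LinearMap.congr_fun (LinearMap.congr_fun this x) y

theorem mul_comm_word [IsCommAssocBracket m] (u v : List D) :
    (mulWord u v : QuasiShuffle K m) = mulWord v u := by
  induction u, v using mulWord.induct with
  | case1 v => cases v <;> simp only [mulWord]
  | case2 a u => simp only [mulWord]
  | case3 a u b v h1 h2 h3 =>
    rw [mulWord, mulWord, h1, h2, h3, IsCommAssocBracket.comm (m := m) a b, add_comm (cons a _)]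

theorem consOption_mul_cons [IsCommAssocBracket m] (o : Option D) (b : D)
    (x y : QuasiShuffle K m) :
    consOption o x * cons b y = consOption o (x * cons b y) + cons b (consOption o x * y) +
      consOption (o.bind fun a => m a b) (x * y) := by
  cases o with
  | none => simp [consOption, mul_eq]
  | some a => exact cons_mul_cons a b x y

theorem cons_mul_consOption [IsCommAssocBracket m] (a : D) (o : Option D)
    (x y : QuasiShuffle K m) :
    cons a x * consOption o y = cons a (x * consOption o y) + consOption o (cons a x * y) +
      consOption (o.bind fun b => m a b) (x * y) := by
  cases o with
  | none => simp [consOption, mul_eq]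
  | some b => exact cons_mul_cons a b x y

protected theorem add_mul' (x y z : QuasiShuffle K m) : (x + y) * z = x * z + y * z := by
  simp [mul_eq]

protected theorem mul_add' (x y z : QuasiShuffle K m) : x * (y + z) = x * y + x * z := by
  simp [mul_eq]

theorem mul_assoc_word [IsCommAssocBracket m] (n : ℕ) : ∀ u v w : List D,
    u.length + v.length + w.length ≤ n →
    (word u * word v * word w : QuasiShuffle K m) = word u * (word v * word w) := by
  induction n with
  | zero =>
    intro u v w h
    have hu : u = [] := List.eq_nil_of_length_eq_zero (by omega)
    rw [hu, ← one_eq, QuasiShuffle.one_mul', QuasiShuffle.one_mul']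
  | succ n ih =>
    intro u v w h
    rcases u with _ | ⟨a, u⟩
    · rw [← one_eq, QuasiShuffle.one_mul', QuasiShuffle.one_mul']
    rcases v with _ | ⟨b, v⟩
    · rw [← one_eq, QuasiShuffle.one_mul', QuasiShuffle.mul_one']
    rcases w with _ | ⟨c, w⟩
    · rw [← one_eq, QuasiShuffle.mul_one', QuasiShuffle.mul_one']
    simp only [List.length_cons] at h
    have h1 := ih u (b :: v) (c :: w) (by simp only [List.length_cons]; omega)
    have h2 := ih (a :: u) v (c :: w) (by simp only [List.length_cons]; omega)
    have h3 := ih u v (c :: w) (by simp only [List.length_cons]; omega)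
    have h4 := ih (a :: u) (b :: v) w (by simp only [List.length_cons]; omega)
    have h5 := ih u (b :: v) w (by simp only [List.length_cons]; omega)
    have h6 := ih (a :: u) v w (by simp only [List.length_cons]; omega)
    have h7 := ih u v w (by omega)
    simp only [← cons_word] at h1 h2 h3 h4 h5 h6 ⊢
    have e1 : (cons a (word u) * cons b (word v) * cons c (word w) : QuasiShuffle K m) =
        cons a (word u * cons b (word v) * cons c (word w)) +
        cons b (cons a (word u) * word v * cons c (word w)) +
        consOption (m a b) (word u * word v * cons c (word w)) +
        cons c (cons a (word u) * cons b (word v) * word w) +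
        consOption (m a c) (word u * cons b (word v) * word w) +
        consOption (m b c) (cons a (word u) * word v * word w) +
        consOption ((m a b).bind fun x => m x c) (word u * word v * word w) := by
      rw [cons_mul_cons a b, QuasiShuffle.add_mul', QuasiShuffle.add_mul', cons_mul_cons,
        cons_mul_cons, consOption_mul_cons]
      rw [QuasiShuffle.add_mul', QuasiShuffle.add_mul', map_add, map_add]
      abel
    have e2 : (cons a (word u) * (cons b (word v) * cons c (word w)) : QuasiShuffle K m) =
        cons a (word u * (cons b (word v) * cons c (word w))) +
        cons b (cons a (word u) * (word v * cons c (word w))) +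
        consOption (m a b) (word u * (word v * cons c (word w))) +
        cons c (cons a (word u) * (cons b (word v) * word w)) +
        consOption (m a c) (word u * (cons b (word v) * word w)) +
        consOption (m b c) (cons a (word u) * (word v * word w)) +
        consOption ((m b c).bind fun y => m a y) (word u * (word v * word w)) := by
      rw [cons_mul_cons b c, QuasiShuffle.mul_add', QuasiShuffle.mul_add', cons_mul_cons,
        cons_mul_cons, cons_mul_consOption]
      rw [QuasiShuffle.mul_add', QuasiShuffle.mul_add', map_add, map_add]
      abel
    rw [e1, e2, h1, h2, h3, h4, h5, h6, h7, IsCommAssocBracket.assoc]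

protected theorem mul_assoc' [IsCommAssocBracket m] (x y z : QuasiShuffle K m) :
    x * y * z = x * (y * z) := by
  induction x using word_induction with
  | h0 => simp [mul_eq]
  | hadd x x' h h' => rw [QuasiShuffle.add_mul', QuasiShuffle.add_mul', h, h',
      QuasiShuffle.add_mul']
  | hw c u =>
    induction y using word_induction with
    | h0 => simp [mul_eq]
    | hadd x x' h h' => rw [QuasiShuffle.mul_add', QuasiShuffle.add_mul', h, h',
        QuasiShuffle.add_mul', QuasiShuffle.mul_add']
    | hw c' v =>
      induction z using word_induction with
      | h0 => simp [mul_eq]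
      | hadd x x' h h' => rw [QuasiShuffle.mul_add', h, h', QuasiShuffle.mul_add',
          QuasiShuffle.mul_add']
      | hw c'' w =>
        have := mul_assoc_word (K := K) (m := m) _ u v w le_rfl
        simp only [mul_eq, map_smul, LinearMap.smul_apply] at this ⊢
        rw [this]

protected theorem mul_comm' [IsCommAssocBracket m] (x y : QuasiShuffle K m) :
    x * y = y * x := by
  have : (mulLin : QuasiShuffle K m →ₗ[K] QuasiShuffle K m →ₗ[K] QuasiShuffle K m) =
      mulLin.flip :=
    lin_ext fun u => lin_ext fun v => by
      rw [LinearMap.flip_apply, ← mul_eq, ← mul_eq, word_mul_word, word_mul_word, mul_comm_word]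
  exact LinearMap.congr_fun (LinearMap.congr_fun this x) y

noncomputable instance [IsCommAssocBracket m] : CommRing (QuasiShuffle K m) where
  left_distrib := QuasiShuffle.mul_add'
  right_distrib := QuasiShuffle.add_mul'
  zero_mul := fun x => by simp [mul_eq]
  mul_zero := fun x => by simp [mul_eq]
  mul_assoc := QuasiShuffle.mul_assoc'
  one_mul := QuasiShuffle.one_mul'
  mul_one := QuasiShuffle.mul_one'
  mul_comm := QuasiShuffle.mul_comm'
  neg_add_cancel := neg_add_cancel
  sub_eq_add_neg := sub_eq_add_neg
  zsmul := fun n x => n • x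
  zsmul_zero' := SubNegMonoid.zsmul_zero'
  zsmul_succ' := SubNegMonoid.zsmul_succ'
  zsmul_neg' := SubNegMonoid.zsmul_neg'

noncomputable instance [IsCommAssocBracket m] : Algebra K (QuasiShuffle K m) :=
  Algebra.ofModule (fun r x y => by simp [mul_eq]) (fun r x y => by simp [mul_eq])

theorem comulLin_cons (a : D) (x : QuasiShuffle K m) :
    comulLin (cons a x) = word [] ⊗ₜ[K] cons a x +
      TensorProduct.map (cons a) LinearMap.id (comulLin x) := by
  have : (comulLin ∘ₗ cons a : QuasiShuffle K m →ₗ[K] _) =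
      (TensorProduct.mk K (QuasiShuffle K m) (QuasiShuffle K m) (word [])) ∘ₗ cons a +
        TensorProduct.map (cons a) LinearMap.id ∘ₗ comulLin :=
    lin_ext fun w => by
      simp only [LinearMap.comp_apply, LinearMap.add_apply, cons_word, comulLin, lift_word,
        TensorProduct.mk_apply, map_sum, TensorProduct.map_tmul, LinearMap.id_apply,
        List.length_cons]
      rw [Finset.sum_range_succ', add_comm]
      rfl
  exact LinearMap.congr_fun this x

theorem comulLin_nil : comulLin (word [] : QuasiShuffle K m) = word [] ⊗ₜ[K] word [] := by
  rw [comulLin, lift_word]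
  rfl

theorem consOption_comul (o : Option D) (x : QuasiShuffle K m) :
    comulLin (consOption o x) = word [] ⊗ₜ[K] consOption o x +
      TensorProduct.map (consOption o) LinearMap.id (comulLin x) := by
  cases o with
  | none => simp [consOption]
  | some a => exact comulLin_cons a x

theorem tensor_cons_mul_cons [IsCommAssocBracket m] (a b : D)
    (x y : QuasiShuffle K m ⊗[K] QuasiShuffle K m) :
    TensorProduct.map (cons a) LinearMap.id x * TensorProduct.map (cons b) LinearMap.id y =
      TensorProduct.map (cons a) LinearMap.id (x * TensorProduct.map (cons b) LinearMap.id y) +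
      TensorProduct.map (cons b) LinearMap.id (TensorProduct.map (cons a) LinearMap.id x * y) +
      TensorProduct.map (consOption (m a b)) LinearMap.id (x * y) := by
  induction x using TensorProduct.induction_on with
  | zero => simp
  | add x x' h h' =>
    simp only [map_add, add_mul, h, h']
    abel
  | tmul x x' =>
    induction y using TensorProduct.induction_on with
    | zero => simp
    | add x x' h h' =>
      simp only [map_add, mul_add, h, h']
      abel
    | tmul y y' =>
      simp only [TensorProduct.map_tmul, Algebra.TensorProduct.tmul_mul_tmul,
        LinearMap.id_apply, cons_mul_cons, TensorProduct.add_tmul]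

theorem one_tmul_mul_map [IsCommAssocBracket m] (f : QuasiShuffle K m →ₗ[K] QuasiShuffle K m)
    (p : QuasiShuffle K m) (y : QuasiShuffle K m ⊗[K] QuasiShuffle K m) :
    1 ⊗ₜ[K] p * TensorProduct.map f LinearMap.id y =
      TensorProduct.map f LinearMap.id (1 ⊗ₜ[K] p * y) := by
  induction y using TensorProduct.induction_on with
  | zero => simp
  | add x x' h h' => simp only [map_add, mul_add, h, h']
  | tmul y y' => simp

theorem comulLin_mulWord [IsCommAssocBracket m] (u v : List D) :
    comulLin (mulWord u v : QuasiShuffle K m) =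
      comulLin (word u : QuasiShuffle K m) * comulLin (word v) := by
  induction u, v using mulWord.induct with
  | case1 v =>
    rw [comulLin_nil, ← one_eq, ← Algebra.TensorProduct.one_def, one_mul]
    cases v <;> simp only [mulWord]
  | case2 a u =>
    rw [comulLin_nil, ← one_eq, ← Algebra.TensorProduct.one_def, mul_one]
    simp only [mulWord]
  | case3 a u b v h1 h2 h3 =>
    have key' : mulWord (a :: u) (b :: v) = (cons a (word u) * cons b (word v) :
      QuasiShuffle K m) := by rw [cons_word, cons_word, word_mul_word]
    rw [mulWord] at key'
    rw [mulWord, map_add, map_add, comulLin_cons, comulLin_cons, consOption_comul, h1, h2, h3]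
    simp only [← cons_word, comulLin_cons, ← one_eq]
    have e1 : ∀ p q r s : QuasiShuffle K m ⊗[K] QuasiShuffle K m,
        (p + q) * (r + s) = p * r + p * s + r * q + q * s := fun p q r s => by ring
    rw [e1, tensor_cons_mul_cons, Algebra.TensorProduct.tmul_mul_tmul, one_mul, ← key',
      one_tmul_mul_map, one_tmul_mul_map, mul_add, add_mul, map_add, map_add, TensorProduct.tmul_add,
      TensorProduct.tmul_add, mul_comm _ (1 ⊗ₜ[K] cons b (word v))]
    abel

theorem comulLin_mul [IsCommAssocBracket m] (x y : QuasiShuffle K m) :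
    comulLin (x * y) = comulLin x * comulLin y := by
  induction x using word_induction with
  | h0 => simp
  | hadd x x' h h' => simp only [add_mul, map_add, h, h']
  | hw c u =>
    induction y using word_induction with
    | h0 => simp
    | hadd x x' h h' => simp only [mul_add, map_add, h, h']
    | hw c' v => simp only [smul_mul_smul_comm, map_smul, word_mul_word, comulLin_mulWord]

theorem counitLin_cons (a : D) (x : QuasiShuffle K m) : counitLin (cons a x) = 0 := by
  have : (counitLin ∘ₗ cons a : QuasiShuffle K m →ₗ[K] K) = 0 :=
    lin_ext fun w => by simp [counitLin]
  exact LinearMap.congr_fun this x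

theorem counitLin_consOption (o : Option D) (x : QuasiShuffle K m) :
    counitLin (consOption o x) = 0 := by
  cases o with
  | none => simp [consOption]
  | some a => exact counitLin_cons a x

theorem counitLin_nil : counitLin (word [] : QuasiShuffle K m) = 1 := by simp [counitLin]

theorem counitLin_mul [IsCommAssocBracket m] (x y : QuasiShuffle K m) :
    counitLin (x * y) = counitLin x * counitLin y := by
  induction x using word_induction with
  | h0 => simp
  | hadd x x' h h' => simp only [add_mul, map_add, h, h']
  | hw c u =>
    induction y using word_induction with
    | h0 => simp
    | hadd x x' h h' => simp only [mul_add, map_add, h, h']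
    | hw c' v =>
      simp only [smul_mul_smul_comm, map_smul]
      congr 1
      rcases u with _ | ⟨a, u⟩
      · rw [← one_eq, one_mul, one_eq, counitLin_nil, one_mul]
      rcases v with _ | ⟨b, v⟩
      · rw [← one_eq, mul_one, one_eq, counitLin_nil, mul_one]
      rw [← cons_word, ← cons_word, cons_mul_cons, map_add, map_add, counitLin_cons,
        counitLin_cons, counitLin_consOption, counitLin_cons, zero_mul, add_zero, add_zero]

theorem lTensor_map_cons {M N : Type*} [AddCommGroup M] [Module K M] [AddCommGroup N] [Module K N]
    (f : M →ₗ[K] N) (a : D) (z : QuasiShuffle K m ⊗[K] M) :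
    LinearMap.lTensor (QuasiShuffle K m) f (TensorProduct.map (cons a) LinearMap.id z) =
      TensorProduct.map (cons a) LinearMap.id (LinearMap.lTensor (QuasiShuffle K m) f z) := by
  induction z using TensorProduct.induction_on with
  | zero => simp
  | add x y hx hy => simp only [map_add, hx, hy]
  | tmul x y => simp

theorem assoc_rTensor_map_cons (a : D) (z : QuasiShuffle K m ⊗[K] QuasiShuffle K m) :
    (TensorProduct.assoc K (QuasiShuffle K m) (QuasiShuffle K m) (QuasiShuffle K m)).toLinearMap
      (LinearMap.rTensor (QuasiShuffle K m) comulLin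
        (TensorProduct.map (cons a) LinearMap.id z)) =
    word [] ⊗ₜ[K] TensorProduct.map (cons a) LinearMap.id z +
      TensorProduct.map (cons a) LinearMap.id
        ((TensorProduct.assoc K (QuasiShuffle K m) (QuasiShuffle K m)
          (QuasiShuffle K m)).toLinearMap
            (LinearMap.rTensor (QuasiShuffle K m) comulLin z)) := by
  induction z using TensorProduct.induction_on with
  | zero => simp
  | add x y hx hy =>
    simp only [map_add, hx, hy, TensorProduct.tmul_add]
    abel
  | tmul x y =>
    have h : ∀ w : QuasiShuffle K m ⊗[K] QuasiShuffle K m,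
        TensorProduct.assoc K (QuasiShuffle K m) (QuasiShuffle K m) (QuasiShuffle K m)
          (TensorProduct.map (cons a) LinearMap.id w ⊗ₜ[K] y) =
        TensorProduct.map (cons a) LinearMap.id
          (TensorProduct.assoc K (QuasiShuffle K m) (QuasiShuffle K m) (QuasiShuffle K m)
            (w ⊗ₜ[K] y)) := by
      intro w
      induction w using TensorProduct.induction_on with
      | zero => simp
      | add x y hx hy => simp only [map_add, TensorProduct.add_tmul, hx, hy]
      | tmul x y => simp
    simp only [TensorProduct.map_tmul, LinearMap.rTensor_tmul, comulLin_cons,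
      TensorProduct.add_tmul, map_add, LinearEquiv.coe_coe, h, TensorProduct.assoc_tmul,
      LinearMap.id_apply]

/-- The deconcatenation coproduct and its counit. -/
noncomputable instance : Coalgebra K (QuasiShuffle K m) where
  comul := comulLin
  counit := counitLin
  coassoc := lin_ext fun w => by
    induction w with
    | nil => simp [comulLin_nil]
    | cons a w ih =>
      simp only [LinearMap.comp_apply] at ih ⊢
      rw [← cons_word, comulLin_cons, map_add, map_add, map_add, assoc_rTensor_map_cons,
        lTensor_map_cons, ih, LinearMap.rTensor_tmul, LinearMap.lTensor_tmul, comulLin_nil,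
        comulLin_cons, TensorProduct.tmul_add]
      simp only [LinearEquiv.coe_coe, TensorProduct.assoc_tmul]
      abel
  rTensor_counit_comp_comul := lin_ext fun w => by
    induction w with
    | nil => simp [comulLin_nil, counitLin_nil]
    | cons a w ih =>
      rw [LinearMap.comp_apply, ← cons_word, comulLin_cons, map_add, LinearMap.rTensor_tmul,
        counitLin_nil, LinearMap.rTensor, ← LinearMap.comp_apply, ← TensorProduct.map_comp]
      have : (counitLin ∘ₗ cons a : QuasiShuffle K m →ₗ[K] K) = 0 :=
        LinearMap.ext fun x => counitLin_cons a x
      rw [this]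
      simp
  lTensor_counit_comp_comul := lin_ext fun w => by
    induction w with
    | nil => simp [comulLin_nil, counitLin_nil]
    | cons a w ih =>
      rw [LinearMap.comp_apply] at ih
      rw [LinearMap.comp_apply, ← cons_word, comulLin_cons, map_add, LinearMap.lTensor_tmul,
        counitLin_cons, TensorProduct.tmul_zero, zero_add, lTensor_map_cons, ih]
      simp

noncomputable instance [IsCommAssocBracket m] : Bialgebra K (QuasiShuffle K m) :=
  Bialgebra.mk' K (QuasiShuffle K m) counitLin_nil (counitLin_mul _ _) comulLin_nil
    (comulLin_mul _ _)

/-- The span of the words with at most `n` letters. -/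
noncomputable def filtration (m : D → D → Option D) (n : ℕ) : Submodule K (QuasiShuffle K m) :=
  Submodule.span K {x | ∃ w : List D, w.length ≤ n ∧ x = word w}

theorem exists_mem_filtration (x : QuasiShuffle K m) : ∃ n, x ∈ filtration (K := K) m n := by
  induction x using word_induction with
  | h0 => exact ⟨0, zero_mem _⟩
  | hadd x y hx hy =>
    obtain ⟨a, ha⟩ := hx
    obtain ⟨b, hb⟩ := hy
    have mono : ∀ {a b : ℕ}, a ≤ b → filtration (K := K) m a ≤ filtration m b := fun h =>
      Submodule.span_mono fun _ ⟨w, hw, hx⟩ => ⟨w, hw.trans h, hx⟩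
    exact ⟨max a b, add_mem (mono (le_max_left a b) ha) (mono (le_max_right a b) hb)⟩
  | hw c w => exact ⟨_, Submodule.smul_mem _ _ (Submodule.subset_span ⟨w, le_rfl, rfl⟩)⟩

theorem comul_word (w : List D) : Coalgebra.comul (R := K) (word w : QuasiShuffle K m) =
    ∑ i ∈ Finset.range (w.length + 1), word (w.take i) ⊗ₜ[K] word (w.drop i) :=
  lift_word _ _

theorem exists_antipode [IsCommAssocBracket m] : ∃ S : QuasiShuffle K m →ₗ[K] QuasiShuffle K m,
    WithConv.toConv S * WithConv.toConv LinearMap.id = 1 ∧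
      WithConv.toConv LinearMap.id * WithConv.toConv S = 1 := by
  refine _root_.exists_antipode (filtration m) exists_mem_filtration fun n x hx => ?_
  induction hx using Submodule.span_induction with
  | mem x hx =>
    obtain ⟨w, hw, rfl⟩ := hx
    rw [comul_word, Finset.sum_range_succ']
    rw [show (word (w.take 0) : QuasiShuffle K m) = 1 from rfl, List.drop_zero,
      add_sub_cancel_right]
    refine Submodule.sum_mem _ fun i hi => ?_
    have := Finset.mem_range.1 hi
    exact Submodule.subset_span ⟨_, (w.drop (i + 1)).length,
      by rw [List.length_drop]; omega, _, Submodule.subset_span ⟨_, le_rfl, rfl⟩, rfl⟩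
  | zero => simp
  | add x y _ _ hx hy =>
    rw [map_add, TensorProduct.tmul_add, add_sub_add_comm]
    exact add_mem hx hy
  | smul a x _ hx =>
    rw [map_smul, TensorProduct.tmul_smul, ← smul_sub]
    exact Submodule.smul_mem _ _ hx

/-- The quasi-shuffle Hopf algebra. -/
noncomputable instance [IsCommAssocBracket m] : HopfAlgebra K (QuasiShuffle K m) :=
  HopfAlgebra.ofConvInverse exists_antipode.choose exists_antipode.choose_spec.1
    exists_antipode.choose_spec.2

end QuasiShuffle

namespace CCK

variable {K : Type*} [Field K] {D : Type*}

/-- The inclusion of the space spanned by the trees with at least one edge. -/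
noncomputable def incl : (NTree D →₀ K) →ₗ[K] CCK K D := Finsupp.linearCombination K X

@[simp] theorem incl_single (T : NTree D) : incl (Finsupp.single T (1 : K)) = X T := by
  simp [incl]

end CCK

/-- The zero bracket. -/
def zeroBracket (D : Type*) : D → D → Option D := fun _ _ => none

/-- The bracket given by a product on `D`. -/
def mulBracket (D : Type*) [CommSemigroup D] : D → D → Option D := fun a b => some (a * b)

instance (D : Type*) : IsCommAssocBracket (zeroBracket D) := ⟨fun _ _ => rfl, fun _ _ _ => rfl⟩

instance (D : Type*) [CommSemigroup D] : IsCommAssocBracket (mulBracket D) :=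
  ⟨fun a b => congrArg some (mul_comm a b), fun a b c => congrArg some (mul_assoc a b c)⟩

/-- The shuffle Hopf algebra. -/
abbrev Sh (K : Type*) [Field K] (D : Type*) : Type _ := QuasiShuffle K (zeroBracket D)

/-- The quasi-shuffle Hopf algebra of a set `D` with an associative and commutative product. -/
abbrev Csh (K : Type*) [Field K] (D : Type*) [CommSemigroup D] : Type _ :=
  QuasiShuffle K (mulBracket D)

namespace QuasiShuffle

variable {K : Type*} [Field K] {D : Type*}

@[simp] theorem proj_letter {m : D → D → Option D} (a : D) :
    proj (word [a] : QuasiShuffle K m) = Finsupp.single a 1 := by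
  ext b
  change (Finsupp.single [a] (1 : K) : List D →₀ K) [b] = _
  classical
  simp [Finsupp.single_apply]

theorem proj_word_of_length_ne_one {m : D → D → Option D} (w : List D) (h : w.length ≠ 1) :
    proj (word w : QuasiShuffle K m) = 0 := by
  ext b
  change (Finsupp.single w (1 : K) : List D →₀ K) [b] = 0
  classical
  rw [Finsupp.single_apply, if_neg]
  rintro rfl
  exact h rfl

/-- The recursion for the shuffle product: `au ⧢ bv = a(u ⧢ bv) + b(au ⧢ v)`. -/
theorem sh_word_mul_word (a b : D) (u v : List D) :
    (word (a :: u) * word (b :: v) : Sh K D) =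
      cons a (word u * word (b :: v)) + cons b (word (a :: u) * word v) := by
  simp only [← cons_word, cons_mul_cons]
  simp [zeroBracket, consOption]

/-- The recursion for the quasi-shuffle product:
`au ⧢ bv = a(u ⧢ bv) + b(au ⧢ v) + [ab](u ⧢ v)`. -/
theorem csh_word_mul_word [CommSemigroup D] (a b : D) (u v : List D) :
    (word (a :: u) * word (b :: v) : Csh K D) =
      cons a (word u * word (b :: v)) + cons b (word (a :: u) * word v) +
        cons (a * b) (word u * word v) := by
  simp only [← cons_word, cons_mul_cons]
  rfl

end QuasiShuffle

/-! The word coalgebra is cofree in the connected sense. Deconcatenation lets an element `y` be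
rebuilt from its counit and its first letters: `y = ε(y) 1 + ∑ π(y₁) · y₂`, where `·` puts a letter
in front of words (`eq_counit_add_actConv`). Applied to `y = Φ x` for a coalgebra morphism `Φ`, with
`ψ = π ∘ Φ`, this becomes the recursion `Φ x = ε(x) 1 + ∑ ψ(x₁) · Φ(x₂)`.

The recursion is well founded. In `Δ x` the empty set of edges gives `1 ⊗ x`, which `ψ(1) = 0`
kills, and every other set contracts an edge, so the right factor has fewer edges. Hence `ψ`
determines `Φ` (`eq_of_eq_add_actConv`).

Multiplicativity forces `ψ` in turn: `π(ab)` depends only on the counits and projections of `a` and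
`b` (`proj_mul`), so `ψ` is known once it is known on trees, where it is `φ`. This gives uniqueness.

For existence, `ψ` is taken to be `π` composed with the algebra morphism sending each tree `T` to
`φ(T)`, so that it satisfies the forced product formula at once. An algebra morphism `Φ` is defined
on trees by the recursion. The recursion passes to products (`actConv_mul`), because the three terms
of `ψ(x₁y₁)` correspond to the three terms of the quasi-shuffle recursion. Finally `Δ ∘ Φ` and `(Φ ⊗
Φ) ∘ Δ` solve one recursion of the same type, hence coincide.

A bracket with values in `D ∪ {0}` covers both cases: the zero bracket gives the shuffle algebra.
Bialgebra morphisms between Hopf algebras commute with the antipodes automatically, so `→ₐc` is the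
right notion of morphism. -/

/-! ### Convolution of two linear maps through an action. -/

/-- The map `x ↦ ∑ N (ψ x₁) (h x₂)`. -/
noncomputable def actConv {K C V M : Type*} [Field K] [AddCommGroup C] [Module K C] [Coalgebra K C]
    [AddCommGroup V] [Module K V] [AddCommGroup M] [Module K M]
    (N : V →ₗ[K] M →ₗ[K] M) (ψ : C →ₗ[K] V) (h : C →ₗ[K] M) : C →ₗ[K] M :=
  TensorProduct.lift (N.compl₁₂ ψ h) ∘ₗ Coalgebra.comul

section ActConv

variable {K C V M : Type*} [Field K] [AddCommGroup C] [Module K C] [Coalgebra K C]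
    [AddCommGroup V] [Module K V] [AddCommGroup M] [Module K M]

theorem actConv_apply (N : V →ₗ[K] M →ₗ[K] M) (ψ : C →ₗ[K] V) (h : C →ₗ[K] M) {x : C}
    {ι : Type*} (r : Coalgebra.Repr K x ι) :
    actConv N ψ h x = ∑ i ∈ r.index, N (ψ (r.left i)) (h (r.right i)) := by
  rw [actConv, LinearMap.comp_apply, ← r.eq, map_sum]
  rfl

theorem actConv_sub (N : V →ₗ[K] M →ₗ[K] M) (ψ : C →ₗ[K] V) (h h' : C →ₗ[K] M) :
    actConv N ψ (h - h') = actConv N ψ h - actConv N ψ h' := by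
  ext x
  simp only [actConv_apply _ _ _ (Coalgebra.Repr.arbitrary K x), LinearMap.sub_apply, map_sub,
    Finset.sum_sub_distrib]

end ActConv

/-! ### Recursion on the number of edges in the algebra of contractions. -/

namespace CCK

variable {K : Type*} [Field K] {D V M : Type*} [AddCommGroup V] [Module K V] [AddCommGroup M]
  [Module K M]

/-- Linear extension of the case of forests, where a nonempty set of contracted edges strictly
lowers the number of edges on the right. Every recursion below is well founded for this reason. -/
theorem comul_sub_mem_lower {n : ℕ} {x : CCK K D} (hx : x ∈ filtration K D n) :
    Coalgebra.comul (R := K) x - 1 ⊗ₜ[K] x ∈ lower K D n := by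
  induction hx using Submodule.span_induction with
  | mem x hx =>
    obtain ⟨F, hF, rfl⟩ := hx
    exact lower_mono hF (comul_ofForest_sub F)
  | zero => simp
  | add x y _ _ hx hy =>
    rw [map_add, TensorProduct.tmul_add, add_sub_add_comm]
    exact add_mem hx hy
  | smul a x _ hx =>
    rw [map_smul, TensorProduct.tmul_smul, ← smul_sub]
    exact Submodule.smul_mem _ _ hx

/-- The term `1 ⊗ x` dies because `ψ 1 = 0`; the right factors of the remaining terms lie in lower
degree, where `h` vanishes. -/
theorem actConv_eq_zero (N : V →ₗ[K] M →ₗ[K] M) {ψ : CCK K D →ₗ[K] V} (hψ : ψ 1 = 0)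
    {h : CCK K D →ₗ[K] M} {n : ℕ} (hh : ∀ m < n, ∀ y ∈ filtration K D m, h y = 0) {x : CCK K D}
    (hx : x ∈ filtration K D n) : actConv N ψ h x = 0 := by
  have h2 : ∀ z ∈ lower K D n, TensorProduct.lift (N.compl₁₂ ψ h) z = 0 := by
    intro z hz
    induction hz using Submodule.span_induction with
    | mem z hz =>
      obtain ⟨a, m, hm, y, hy, rfl⟩ := hz
      simp [hh m hm y hy]
    | zero => simp
    | add x y _ _ hx hy => rw [map_add, hx, hy, add_zero]
    | smul a x _ hx => rw [map_smul, hx, smul_zero]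
  have h3 := h2 _ (comul_sub_mem_lower hx)
  rwa [map_sub, TensorProduct.lift.tmul, LinearMap.compl₁₂_apply, hψ, map_zero,
    LinearMap.zero_apply, sub_zero] at h3

/-- By linearity in `h`: in degree `n` the convolution sees only the values of `h` in degrees below
`n`, so it can serve as the right-hand side of a recursive definition. -/
theorem actConv_congr (N : V →ₗ[K] M →ₗ[K] M) {ψ : CCK K D →ₗ[K] V} (hψ : ψ 1 = 0)
    {h h' : CCK K D →ₗ[K] M} {n : ℕ} (hh : ∀ m < n, ∀ y ∈ filtration K D m, h y = h' y)
    {x : CCK K D} (hx : x ∈ filtration K D n) : actConv N ψ h x = actConv N ψ h' x := by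
  rw [← sub_eq_zero, ← LinearMap.sub_apply, ← actConv_sub]
  exact actConv_eq_zero N hψ (fun m hm y hy => sub_eq_zero.2 (hh m hm y hy)) hx

/-- The equation `h = g + ∑ N (ψ x₁) (h x₂)` has at most one solution. -/
theorem eq_of_eq_add_actConv (N : V →ₗ[K] M →ₗ[K] M) {ψ : CCK K D →ₗ[K] V} (hψ : ψ 1 = 0)
    {g h h' : CCK K D →ₗ[K] M} (hh : h = g + actConv N ψ h) (hh' : h' = g + actConv N ψ h') :
    h = h' := by
  -- Strong induction on the degree: replacing `h` and `h'` by their equations leaves only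
  -- convolutions, which agree by the lower degrees.
  have key : ∀ n, ∀ x ∈ filtration K D n, h x = h' x := by
    intro n
    induction n using Nat.strong_induction_on with
    | _ n ih =>
      intro x hx
      rw [hh, hh', LinearMap.add_apply, LinearMap.add_apply, actConv_congr N hψ ih hx]
  ext x
  obtain ⟨n, hn⟩ := exists_mem_filtration x
  exact key n x hn

/-- Each tree of a forest with at most `n` edges has itself at most `n` edges. This carries
information on small trees to the right factors of coproducts, which are known only through the
filtration. -/
theorem eq_on_filtration {A : Type*} [CommRing A] [Algebra K A] {f g : CCK K D →ₐ[K] A} {n : ℕ}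
    (h : ∀ T : RTree D, T.numEdges ≤ n → f (ofTree T) = g (ofTree T)) {x : CCK K D}
    (hx : x ∈ filtration K D n) : f x = g x := by
  induction hx using Submodule.span_induction with
  | mem x hx =>
    obtain ⟨F, hF, rfl⟩ := hx
    induction F using Multiset.induction_on with
    | empty => simp
    | cons T F ih =>
      rw [Multiset.map_cons, Multiset.sum_cons] at hF
      rw [ofForest_cons, map_mul, map_mul, h T (by omega), ih (by omega)]
  | zero => simp
  | add x y _ _ hx hy => rw [map_add, map_add, hx, hy]
  | smul a x _ hx => rw [map_smul, map_smul, hx]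

end CCK

/-! ### First letters of words and the quasi-shuffle product. -/

namespace QuasiShuffle

variable {K : Type*} [Field K] {D : Type*} {m : D → D → Option D}

/-- Adding a linear combination of letters at the beginning of words. -/
noncomputable def consLin : (D →₀ K) →ₗ[K] QuasiShuffle K m →ₗ[K] QuasiShuffle K m :=
  Finsupp.linearCombination K cons

@[simp] theorem consLin_single (a : D) :
    (consLin (Finsupp.single a (1 : K)) : QuasiShuffle K m →ₗ[K] QuasiShuffle K m) = cons a := by
  simp [consLin]

/-- The inclusion of the space spanned by the letters. -/
noncomputable def letters : (D →₀ K) →ₗ[K] QuasiShuffle K m := consLin.flip (word [])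

theorem finsupp_ext {M : Type*} [AddCommGroup M] [Module K M] {f g : (D →₀ K) →ₗ[K] M}
    (h : ∀ a, f (Finsupp.single a 1) = g (Finsupp.single a 1)) : f = g :=
  Finsupp.lhom_ext' fun a => LinearMap.ext_ring (h a)

/-- A word with a letter put in front has length one exactly when the original word is empty, and
the counit reads off the coefficient of the empty word. -/
theorem proj_consLin (v : D →₀ K) (y : QuasiShuffle K m) :
    proj (consLin v y) = counitLin y • v := by
  have : consLin.compr₂ proj = ((LinearMap.lsmul K (D →₀ K)).flip.compl₂ counitLin :
      (D →₀ K) →ₗ[K] QuasiShuffle K m →ₗ[K] (D →₀ K)) :=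
    finsupp_ext fun a => lin_ext fun w => by
      rcases w with _ | ⟨b, w⟩
      · simp [counitLin_nil]
      · simp only [LinearMap.compr₂_apply, consLin_single, cons_word]
        rw [proj_word_of_length_ne_one _ (by simp), ← cons_word, LinearMap.compl₂_apply,
          counitLin_cons]
        simp
  exact LinearMap.congr_fun (LinearMap.congr_fun this v) y

theorem counitLin_consLin (v : D →₀ K) (y : QuasiShuffle K m) : counitLin (consLin v y) = 0 := by
  have : consLin.compr₂ counitLin = (0 : (D →₀ K) →ₗ[K] QuasiShuffle K m →ₗ[K] K) :=
    finsupp_ext fun a => LinearMap.ext fun x => by simp [counitLin_cons]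
  exact LinearMap.congr_fun (LinearMap.congr_fun this v) y

theorem proj_letters (v : D →₀ K) : proj (letters v : QuasiShuffle K m) = v := by
  rw [letters, LinearMap.flip_apply, proj_consLin, counitLin_nil, one_smul]

theorem proj_one : proj (1 : QuasiShuffle K m) = 0 := proj_word_of_length_ne_one [] (by simp)

/-- An element of `D ∪ {0}` is seen as a vector in the span of the letters, so that the bracket can
be treated linearly. -/
theorem consOption_eq (o : Option D) :
    (consOption o : QuasiShuffle K m →ₗ[K] QuasiShuffle K m) =
      consLin (proj (consOption o (word []) : QuasiShuffle K m)) := by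
  cases o <;> simp [consOption]

/-- In the first two terms of the quasi-shuffle recursion a letter is put in front of an element
with counit zero, so no single letter appears. Only the bracket term survives, weighted by the
counit of `x * y`; the product of the two letters is the case `x = y = 1`. -/
theorem proj_cons_mul_cons (a b : D) (x y : QuasiShuffle K m) [IsCommAssocBracket m] :
    proj (cons a x * cons b y) = counitLin (x * y) • proj (letters (Finsupp.single a (1 : K)) *
      letters (Finsupp.single b 1) : QuasiShuffle K m) := by
  have h : ∀ (a b : D) (x y : QuasiShuffle K m), proj (cons a (x * cons b y)) = 0 ∧
      proj (cons b (cons a x * y)) = 0 := by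
    intro a b x y
    rw [← consLin_single, ← consLin_single, proj_consLin, proj_consLin, counitLin_mul,
      counitLin_mul, counitLin_consLin, counitLin_consLin]
    simp
  simp only [letters, LinearMap.flip_apply, consLin_single]
  rw [cons_mul_cons, cons_mul_cons, map_add, map_add, map_add, map_add, (h a b x y).1,
    (h a b x y).2, (h a b _ _).1, (h a b _ _).2, ← one_eq, mul_one, consOption_eq, proj_consLin,
    one_eq, proj_consLin, counitLin_nil, one_smul]
  simp

/-- The projection of a product on the space spanned by the letters. -/
theorem proj_mul [IsCommAssocBracket m] (x y : QuasiShuffle K m) :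
    proj (x * y) = counitLin x • proj y + counitLin y • proj x +
      proj (letters (proj x) * letters (proj y) : QuasiShuffle K m) := by
  induction x using word_induction with
  | h0 => simp
  | hadd x x' h h' =>
    simp only [add_mul, map_add, h, h', add_smul, smul_add]
    abel
  | hw c u =>
    induction y using word_induction with
    | h0 => simp
    | hadd x x' h h' =>
      simp only [mul_add, map_add, h, h', add_smul, smul_add]
      abel
    | hw c' v =>
      simp only [smul_mul_smul_comm, map_smul, smul_eq_mul, mul_smul, smul_comm _ c', ← smul_add]
      congr 2
      -- An empty word is the unit, with zero projection, which leaves one counit term. For two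
      -- nonempty words both counits vanish and only the bracket term remains.
      rcases u with _ | ⟨a, u⟩
      · rw [← one_eq, one_mul, proj_one, one_eq, counitLin_nil]
        simp
      rcases v with _ | ⟨b, v⟩
      · rw [← one_eq, mul_one, proj_one, one_eq, counitLin_nil]
        simp
      rw [← cons_word, ← cons_word, counitLin_cons, counitLin_cons, proj_cons_mul_cons]
      simp only [← consLin_single, proj_consLin, map_smul, smul_mul_smul_comm, counitLin_mul]
      simp

/-- Bilinear extension of the quasi-shuffle recursion. The bracket of two vectors is expressed as
the projection of their product, the same expression as in `proj_mul`, so the two formulas can be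
matched term by term. -/
theorem consLin_mul_consLin [IsCommAssocBracket m] (v w : D →₀ K) (x y : QuasiShuffle K m) :
    consLin v x * consLin w y = consLin v (x * consLin w y) + consLin w (consLin v x * y) +
      consLin (proj (letters v * letters w : QuasiShuffle K m)) (x * y) := by
  induction v using Finsupp.induction_linear with
  | zero => simp
  | add v v' h h' =>
    simp only [map_add, LinearMap.add_apply, add_mul, h, h']
    abel
  | single a c =>
    rw [← Finsupp.smul_single_one]
    simp only [map_smul, LinearMap.smul_apply, smul_mul_assoc, ← smul_add]
    congr 1
    induction w using Finsupp.induction_linear with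
    | zero => simp
    | add v v' h h' =>
      simp only [map_add, LinearMap.add_apply, mul_add, h, h']
      abel
    | single b c =>
      rw [← Finsupp.smul_single_one b c]
      simp only [map_smul, LinearMap.smul_apply, mul_smul_comm, ← smul_add]
      congr 1
      -- The product of the letters `a` and `b` is `ab + ba + [ab]`, and the projection kills the
      -- two words of length two.
      have h : proj (letters (Finsupp.single a (1 : K)) * letters (Finsupp.single b 1) :
          QuasiShuffle K m) = proj (consOption (m a b) (word []) : QuasiShuffle K m) := by
        simp only [letters, LinearMap.flip_apply, consLin_single]
        rw [cons_mul_cons, ← one_eq, mul_one, mul_one, one_mul, map_add, map_add, one_eq, cons_word,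
          cons_word, cons_word, cons_word, proj_word_of_length_ne_one _ (by simp),
          proj_word_of_length_ne_one _ (by simp), zero_add, zero_add]
      rw [h, ← consOption_eq, consLin_single, consLin_single, cons_mul_cons]

/-- The form suited to a product of two Sweedler sums: in the first two terms one factor is kept as
a whole sum, ready to be recognised as a convolution. -/
theorem sum_consLin_mul_sum_consLin [IsCommAssocBracket m] {ι κ : Type*} (I : Finset ι)
    (J : Finset κ) (v : ι → D →₀ K) (w : κ → D →₀ K) (x : ι → QuasiShuffle K m)
    (y : κ → QuasiShuffle K m) :
    (∑ i ∈ I, consLin (v i) (x i)) * (∑ j ∈ J, consLin (w j) (y j)) =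
      ∑ i ∈ I, consLin (v i) (x i * ∑ j ∈ J, consLin (w j) (y j)) +
      ∑ j ∈ J, consLin (w j) ((∑ i ∈ I, consLin (v i) (x i)) * y j) +
      ∑ i ∈ I, ∑ j ∈ J, consLin (proj (letters (v i) * letters (w j) : QuasiShuffle K m))
        (x i * y j) := by
  have h1 : ∀ i, consLin (v i) (x i * ∑ j ∈ J, consLin (w j) (y j)) =
      ∑ j ∈ J, consLin (v i) (x i * consLin (w j) (y j)) := fun i => by
    rw [Finset.mul_sum, map_sum]
  have h2 : ∀ j, consLin (w j) ((∑ i ∈ I, consLin (v i) (x i)) * y j) =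
      ∑ i ∈ I, consLin (w j) (consLin (v i) (x i) * y j) := fun j => by
    rw [Finset.sum_mul, map_sum]
  rw [Finset.sum_mul_sum, Finset.sum_congr rfl fun i _ => h1 i,
    Finset.sum_congr rfl fun j _ => h2 j, Finset.sum_comm (s := J), ← Finset.sum_add_distrib,
    ← Finset.sum_add_distrib]
  refine Finset.sum_congr rfl fun i _ => ?_
  rw [← Finset.sum_add_distrib, ← Finset.sum_add_distrib]
  exact Finset.sum_congr rfl fun j _ => consLin_mul_consLin _ _ _ _

/-- Either the cut comes before the new first letter, or that letter stays with the left factor.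
Writing the second term with `rTensorHom` makes it linear in `v`, hence an action usable in
`actConv`. -/
theorem comulLin_consLin (v : D →₀ K) (x : QuasiShuffle K m) :
    comulLin (consLin v x) = word [] ⊗ₜ[K] consLin v x +
      LinearMap.rTensorHom (QuasiShuffle K m) (consLin v) (comulLin x) := by
  induction v using Finsupp.induction_linear with
  | zero => simp
  | add v v' h h' =>
    simp only [map_add, LinearMap.add_apply, h, h', TensorProduct.tmul_add]
    abel
  | single a c =>
    rw [← Finsupp.smul_single_one]
    simp only [map_smul, LinearMap.smul_apply, TensorProduct.tmul_smul, ← smul_add]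
    congr 1
    rw [consLin_single]
    exact comulLin_cons a x

/-- Every element is recovered from its counit and the first letters of its words. -/
theorem eq_counit_add_actConv :
    (LinearMap.id : QuasiShuffle K m →ₗ[K] QuasiShuffle K m) =
      counitLin.smulRight (word []) + actConv consLin proj LinearMap.id := by
  refine lin_ext fun w => ?_
  rw [LinearMap.add_apply, actConv, LinearMap.comp_apply]
  change _ = _ + TensorProduct.lift _ (comulLin _)
  rcases w with _ | ⟨a, w⟩
  · rw [comulLin_nil]
    rw [LinearMap.smulRight_apply, counitLin_nil, TensorProduct.lift.tmul,
      LinearMap.compl₁₂_apply, ← one_eq, proj_one]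
    simp
  -- With `a` in front of the left factor, the projection keeps only `a` times the counit of the
  -- former left factor. What remains is the counit axiom for `w`, which is `h'`.
  · have h : ∀ z : QuasiShuffle K m ⊗[K] QuasiShuffle K m,
        TensorProduct.lift (consLin.compl₁₂ proj LinearMap.id)
          (TensorProduct.map (cons a) LinearMap.id z) =
        cons a (TensorProduct.lift ((LinearMap.lsmul K _).comp counitLin) z) := by
      intro z
      induction z using TensorProduct.induction_on with
      | zero => simp
      | add x y hx hy => simp only [map_add, hx, hy]
      | tmul x y => simp [← consLin_single, proj_consLin, -Finsupp.smul_single]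
    have h' : TensorProduct.lift ((LinearMap.lsmul K _).comp counitLin)
        (comulLin (word w : QuasiShuffle K m)) = word w := by
      have := Coalgebra.sum_counit_smul (Coalgebra.Repr.arbitrary K (word w : QuasiShuffle K m))
      refine Eq.trans ?_ this
      change TensorProduct.lift _ (Coalgebra.comul _) = _
      rw [← (Coalgebra.Repr.arbitrary K (word w : QuasiShuffle K m)).eq, map_sum]
      rfl
    rw [← cons_word, comulLin_cons, map_add, h, h', LinearMap.smulRight_apply, counitLin_cons,
      ← one_eq]
    simp [proj_one]

end QuasiShuffle

/-! ### Construction of the algebra morphism. -/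

namespace CCK

variable {K : Type*} [Field K] {D : Type*} {m : D → D → Option D} [IsCommAssocBracket m]

open QuasiShuffle

/-- The algebra morphism which sends a tree to a linear combination of letters. -/
noncomputable def letterHom (m : D → D → Option D) [IsCommAssocBracket m]
    (φ : (NTree D →₀ K) →ₗ[K] (D →₀ K)) : CCK K D →ₐ[K] QuasiShuffle K m :=
  lift fun T => letters (φ (Finsupp.single T 1))

/-- The linear map which is to be the projection of the morphism to the letters. -/
noncomputable def letterPart (m : D → D → Option D) [IsCommAssocBracket m]
    (φ : (NTree D →₀ K) →ₗ[K] (D →₀ K)) : CCK K D →ₗ[K] (D →₀ K) :=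
  proj ∘ₗ (letterHom m φ).toLinearMap

variable (φ : (NTree D →₀ K) →ₗ[K] (D →₀ K))

theorem letterPart_X (T : NTree D) : letterPart m φ (X T) = φ (Finsupp.single T 1) := by
  simp [letterPart, letterHom, proj_letters]

theorem letterPart_one : letterPart m φ 1 = 0 := by
  simp [letterPart, proj_one]

theorem counit_X (T : NTree D) : Coalgebra.counit (R := K) (X T : CCK K D) = 0 := lift_X _ _

/-- Both sides are algebra morphisms to `K` which vanish on every tree with an edge. -/
theorem counit_letterHom (x : CCK K D) :
    counitLin (letterHom m φ x) = Coalgebra.counit (R := K) x := by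
  have : (Bialgebra.counitAlgHom K (QuasiShuffle K m)).comp (letterHom m φ) =
      Bialgebra.counitAlgHom K (CCK K D) := algHom_ext fun T => by
    refine Eq.trans ?_ (counit_X T).symm
    rw [AlgHom.comp_apply, letterHom, lift_X]
    exact counitLin_consLin _ _
  exact DFunLike.congr_fun this x

/-- Inherited from `proj_mul`, since `letterPart` is the projection of an algebra morphism. This is
the purpose of `letterHom`: it extends `φ` to forests by the only formula compatible with products.
-/
theorem letterPart_mul (x y : CCK K D) : letterPart m φ (x * y) =
    Coalgebra.counit (R := K) x • letterPart m φ y +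
    Coalgebra.counit (R := K) y • letterPart m φ x +
    proj (letters (letterPart m φ x) * letters (letterPart m φ y) : QuasiShuffle K m) := by
  rw [← counit_letterHom (m := m) φ x, ← counit_letterHom (m := m) φ y]
  simp only [letterPart, LinearMap.comp_apply, AlgHom.toLinearMap_apply, map_mul]
  exact proj_mul _ _

/-- Approximations of the morphism, exact on trees with at most `n` edges. -/
noncomputable def approx (m : D → D → Option D) [IsCommAssocBracket m]
    (φ : (NTree D →₀ K) →ₗ[K] (D →₀ K)) : ℕ → CCK K D →ₐ[K] QuasiShuffle K m
  -- The starting value does not matter: it is relied on only for the one-vertex tree, that is on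
  -- scalars, where all algebra morphisms agree.
  | 0 => letterHom m φ
  | n + 1 => lift fun T => actConv consLin (letterPart m φ) (approx m φ n).toLinearMap (X T)

/-- The approximations stabilise: on a tree with at most `n + 1` edges the convolution uses only
degrees at most `n`, where the previous approximations already agree. -/
theorem approx_eq (n : ℕ) : ∀ k, n ≤ k → ∀ T : RTree D, T.numEdges ≤ n →
    approx m φ k (ofTree T) = approx m φ n (ofTree T) := by
  induction n with
  | zero =>
    intro k _ T hT
    rw [RTree.numEdges_eq_zero.1 (Nat.le_zero.1 hT)]
    simp
  | succ n ih =>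
    intro k hk T hT
    obtain ⟨k, rfl⟩ : ∃ l, k = l + 1 := ⟨k - 1, by omega⟩
    by_cases h : T = RTree.nil
    · simp [h]
    · have hm := filtration_mono (K := K) hT (ofTree_mem T)
      rw [ofTree_coe ⟨T, h⟩] at hm ⊢
      rw [approx, approx, lift_X, lift_X]
      refine actConv_congr _ (letterPart_one φ) (fun i hi y hy => ?_) hm
      exact eq_on_filtration (fun S hS => ih k (by omega) S (by omega)) hy

/-- The Hopf algebra morphism with a given projection to the letters, as an algebra morphism. -/
noncomputable def toQuasiShuffle (m : D → D → Option D) [IsCommAssocBracket m]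
    (φ : (NTree D →₀ K) →ₗ[K] (D →₀ K)) : CCK K D →ₐ[K] QuasiShuffle K m :=
  lift fun T => approx m φ T.tree.numEdges (X T)

theorem toQuasiShuffle_ofTree {n : ℕ} {T : RTree D} (hT : T.numEdges ≤ n) :
    toQuasiShuffle m φ (ofTree T) = approx m φ n (ofTree T) := by
  rw [approx_eq φ _ n hT T le_rfl]
  by_cases h : T = RTree.nil
  · simp [h]
  · rw [ofTree_coe ⟨T, h⟩, toQuasiShuffle, lift_X]

/-- On a tree with `n + 1` edges the morphism is approximation `n + 1`, defined by convolution with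
approximation `n`, and the latter agrees with the morphism in all degrees that occur. The counit
term of the recursion is absent since `T` has an edge. -/
theorem toQuasiShuffle_X (T : NTree D) : toQuasiShuffle m φ (X T) =
    actConv consLin (letterPart m φ) (toQuasiShuffle m φ).toLinearMap (X T) := by
  obtain ⟨n, hn⟩ : ∃ n, T.tree.numEdges = n + 1 :=
    Nat.exists_eq_succ_of_ne_zero fun h => T.ne_nil (RTree.numEdges_eq_zero.1 h)
  have hm := ofTree_mem (K := K) T.tree
  rw [ofTree_coe, hn] at hm
  rw [← ofTree_coe, toQuasiShuffle_ofTree φ hn.le, ofTree_coe, approx, lift_X]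
  refine actConv_congr _ (letterPart_one φ) (fun i hi y hy => ?_) hm
  exact (eq_on_filtration (fun S hS => toQuasiShuffle_ofTree φ (hS.trans (by omega))) hy).symm

/-- The three terms of `ψ(x₁y₁)` given by `letterPart_mul` produce the three terms of the
quasi-shuffle product of the two convolutions; the extra terms are accounted for by the counit parts
of `Φ x` and `Φ y`. -/
theorem actConv_mul (Φ : CCK K D →ₐ[K] QuasiShuffle K m) {x y : CCK K D}
    (hx : Φ x = Coalgebra.counit (R := K) x • 1 +
      actConv consLin (letterPart m φ) Φ.toLinearMap x)
    (hy : Φ y = Coalgebra.counit (R := K) y • 1 +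
      actConv consLin (letterPart m φ) Φ.toLinearMap y) :
    Φ (x * y) = Coalgebra.counit (R := K) (x * y) • 1 +
      actConv consLin (letterPart m φ) Φ.toLinearMap (x * y) := by
  set ψ := letterPart m φ with hψ
  have r := Coalgebra.Repr.arbitrary K x
  have s := Coalgebra.Repr.arbitrary K y
  have hX : actConv consLin ψ Φ.toLinearMap x =
      ∑ i ∈ r.index, consLin (ψ (r.left i)) (Φ (r.right i)) := actConv_apply _ _ _ r
  have hY : actConv consLin ψ Φ.toLinearMap y =
      ∑ j ∈ s.index, consLin (ψ (s.left j)) (Φ (s.right j)) := actConv_apply _ _ _ s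
  have hXY : actConv consLin ψ Φ.toLinearMap (x * y) = ∑ i ∈ r.index, ∑ j ∈ s.index,
      consLin (ψ (r.left i * s.left j)) (Φ (r.right i) * Φ (s.right j)) := by
    rw [actConv, LinearMap.comp_apply, Bialgebra.comul_mul, ← r.eq, ← s.eq, Finset.sum_mul_sum]
    simp
  have hx' : ∑ i ∈ r.index, Coalgebra.counit (R := K) (r.left i) • Φ (r.right i) = Φ x := by
    simp only [← map_smul, ← map_sum, Coalgebra.sum_counit_smul]
  have hy' : ∑ j ∈ s.index, Coalgebra.counit (R := K) (s.left j) • Φ (s.right j) = Φ y := by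
    simp only [← map_smul, ← map_sum, Coalgebra.sum_counit_smul]
  -- The counit axiom for `x` collapses the sum over `i` and restores the whole of `Φ x`; `h2` is
  -- the mirror image for `y`.
  have h1 : ∑ i ∈ r.index, ∑ j ∈ s.index, consLin (Coalgebra.counit (R := K) (r.left i) •
      ψ (s.left j)) (Φ (r.right i) * Φ (s.right j)) =
      ∑ j ∈ s.index, consLin (ψ (s.left j)) (Φ x * Φ (s.right j)) := by
    rw [Finset.sum_comm, ← hx']
    simp only [map_smul, LinearMap.smul_apply, Finset.sum_mul, map_sum, smul_mul_assoc]
  have h2 : ∑ i ∈ r.index, ∑ j ∈ s.index, consLin (Coalgebra.counit (R := K) (s.left j) •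
      ψ (r.left i)) (Φ (r.right i) * Φ (s.right j)) =
      ∑ i ∈ r.index, consLin (ψ (r.left i)) (Φ (r.right i) * Φ y) := by
    rw [← hy']
    simp only [map_smul, LinearMap.smul_apply, Finset.mul_sum, map_sum, mul_smul_comm]
  have h3 : actConv consLin ψ Φ.toLinearMap x * actConv consLin ψ Φ.toLinearMap y =
      ∑ i ∈ r.index, consLin (ψ (r.left i))
        (Φ (r.right i) * actConv consLin ψ Φ.toLinearMap y) +
      ∑ j ∈ s.index, consLin (ψ (s.left j))
        (actConv consLin ψ Φ.toLinearMap x * Φ (s.right j)) +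
      ∑ i ∈ r.index, ∑ j ∈ s.index, consLin (proj (letters (ψ (r.left i)) *
        letters (ψ (s.left j)) : QuasiShuffle K m)) (Φ (r.right i) * Φ (s.right j)) := by
    rw [hX, hY]
    exact sum_consLin_mul_sum_consLin _ _ _ _ _ _
  have h4 : actConv consLin ψ Φ.toLinearMap (x * y) =
      ∑ j ∈ s.index, consLin (ψ (s.left j)) (Φ x * Φ (s.right j)) +
      ∑ i ∈ r.index, consLin (ψ (r.left i)) (Φ (r.right i) * Φ y) +
      ∑ i ∈ r.index, ∑ j ∈ s.index, consLin (proj (letters (ψ (r.left i)) *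
        letters (ψ (s.left j)) : QuasiShuffle K m)) (Φ (r.right i) * Φ (s.right j)) := by
    rw [hXY, ← h1, ← h2]
    simp only [hψ, letterPart_mul, map_add, LinearMap.add_apply, Finset.sum_add_distrib]
  -- Substituting the recursion for `Φ x` splits off a multiple of the convolution at `y`; the rest
  -- is a term of `h3`. In `h6` the roles are exchanged.
  have h5 : ∑ j ∈ s.index, consLin (ψ (s.left j)) (Φ x * Φ (s.right j)) =
      Coalgebra.counit (R := K) x • actConv consLin ψ Φ.toLinearMap y +
      ∑ j ∈ s.index, consLin (ψ (s.left j))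
        (actConv consLin ψ Φ.toLinearMap x * Φ (s.right j)) := by
    rw [hY, hx]
    simp only [add_mul, map_add, Finset.sum_add_distrib, smul_mul_assoc, one_mul, map_smul,
      Finset.smul_sum]
  have h6 : ∑ i ∈ r.index, consLin (ψ (r.left i)) (Φ (r.right i) * Φ y) =
      Coalgebra.counit (R := K) y • actConv consLin ψ Φ.toLinearMap x +
      ∑ i ∈ r.index, consLin (ψ (r.left i))
        (Φ (r.right i) * actConv consLin ψ Φ.toLinearMap y) := by
    rw [hX, hy]
    simp only [mul_add, map_add, Finset.sum_add_distrib, mul_smul_comm, mul_one, map_smul,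
      Finset.smul_sum]
  rw [h4, h5, h6, map_mul, hx, hy, add_mul, mul_add, mul_add, h3, Bialgebra.counit_mul,
    smul_mul_smul_comm, mul_one, smul_mul_assoc, one_mul, mul_smul_comm, mul_one]
  abel

/-- The recursion holds at `1` and on trees, is linear, and passes to products, so it holds on the
whole polynomial algebra. -/
theorem toQuasiShuffle_apply (x : CCK K D) : toQuasiShuffle m φ x =
    Coalgebra.counit (R := K) x • 1 +
      actConv consLin (letterPart m φ) (toQuasiShuffle m φ).toLinearMap x := by
  have h1 : (toQuasiShuffle m φ 1 : QuasiShuffle K m) = Coalgebra.counit (R := K) (1 : CCK K D) • 1 +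
      actConv consLin (letterPart m φ) (toQuasiShuffle m φ).toLinearMap 1 := by
    rw [actConv, LinearMap.comp_apply, Bialgebra.comul_one, Algebra.TensorProduct.one_def]
    simp [letterPart_one]
  induction x using induction_on with
  | hC a =>
    rw [Algebra.algebraMap_eq_smul_one, map_smul, h1]
    simp only [map_smul, smul_add, smul_assoc]
  | hadd p q hp hq =>
    rw [map_add, map_add, map_add, hp, hq, add_smul]
    abel
  | hX p T hp =>
    refine actConv_mul φ _ hp ?_
    rw [counit_X, zero_smul, zero_add]
    exact toQuasiShuffle_X φ T

/-! ### Compatibility with the counit, the projection and the coproduct. -/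

/-- In the recursion every term of the convolution starts with a letter, so the counit sees only the
multiple of the unit. -/
theorem counit_toQuasiShuffle (x : CCK K D) :
    counitLin (toQuasiShuffle m φ x) = Coalgebra.counit (R := K) x := by
  rw [toQuasiShuffle_apply, actConv_apply _ _ _ (Coalgebra.Repr.arbitrary K x), map_add, map_sum]
  simp [counitLin_consLin, one_eq, counitLin_nil]

/-- Projecting the recursion leaves `∑ ε(Φ x₂) ψ(x₁)`, which is `ψ(x)` because `Φ` preserves the
counit. -/
theorem proj_toQuasiShuffle (x : CCK K D) : proj (toQuasiShuffle m φ x) = letterPart m φ x := by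
  have r := Coalgebra.Repr.arbitrary K x
  have h : ∑ i ∈ r.index, Coalgebra.counit (R := K) (r.right i) • r.left i = x := by
    simpa only [map_sum, TensorProduct.lift.tmul, LinearMap.flip_apply, LinearMap.lsmul_apply,
      one_smul] using congr(TensorProduct.lift (LinearMap.lsmul K (CCK K D)).flip
        $(Coalgebra.sum_tmul_counit_eq (R := K) r))
  rw [toQuasiShuffle_apply, actConv_apply _ _ _ r, map_add, map_sum, map_smul, proj_one,
    smul_zero, zero_add]
  conv_rhs => rw [← h, map_sum]
  simp only [proj_consLin, AlgHom.toLinearMap_apply, counit_toQuasiShuffle, map_smul]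

/-- The map `Φ ⊗ Φ` applied to the coproduct satisfies the equation of the coproduct of `Φ`. -/
theorem comul_toQuasiShuffle (x : CCK K D) :
    comulLin (toQuasiShuffle m φ x) = TensorProduct.map (toQuasiShuffle m φ).toLinearMap
      (toQuasiShuffle m φ).toLinearMap (Coalgebra.comul (R := K) x) := by
  set Φ := toQuasiShuffle m φ with hΦ
  set ψ := letterPart m φ with hψ
  -- The action putting letters in front of the left tensor factor only.
  set N : (D →₀ K) →ₗ[K] _ := LinearMap.rTensorHom (QuasiShuffle K m) ∘ₗ
    (consLin (m := m) (K := K)) with hN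
  -- Deconcatenating the recursion for `Φ x`: the cuts before the first letter, together with the
  -- counit term, add up to `1 ⊗ Φ x`; the other cuts form the convolution.
  have e1 : comulLin ∘ₗ Φ.toLinearMap = (TensorProduct.mk K _ _ 1 ∘ₗ Φ.toLinearMap) +
      actConv N ψ (comulLin ∘ₗ Φ.toLinearMap) := by
    ext x
    have r := Coalgebra.Repr.arbitrary K x
    rw [LinearMap.add_apply, actConv_apply _ _ _ r, LinearMap.comp_apply, LinearMap.comp_apply,
      AlgHom.toLinearMap_apply, hΦ, toQuasiShuffle_apply, ← hΦ, actConv_apply _ _ _ r]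
    simp only [map_add, map_sum, map_smul, comulLin_consLin, Finset.sum_add_distrib, one_eq,
      comulLin_nil, TensorProduct.mk_apply, ← TensorProduct.tmul_sum]
    rw [add_assoc]
    rfl
  -- Here the recursion is applied to `Φ(x₁)` in the left factor. Its counit terms sum to `1 ⊗ Φ x`,
  -- and coassociativity turns the rest into the convolution; `h` expresses that `N` leaves the
  -- right factor alone.
  have e2 : TensorProduct.map Φ.toLinearMap Φ.toLinearMap ∘ₗ Coalgebra.comul =
      (TensorProduct.mk K _ _ 1 ∘ₗ Φ.toLinearMap) +
      actConv N ψ (TensorProduct.map Φ.toLinearMap Φ.toLinearMap ∘ₗ Coalgebra.comul) := by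
    ext x
    have r := Coalgebra.Repr.arbitrary K x
    have h : ∀ u : CCK K D ⊗[K] CCK K D, ∀ c : CCK K D,
        TensorProduct.lift (consLin.compl₁₂ ψ Φ.toLinearMap) u ⊗ₜ[K] Φ c =
        TensorProduct.lift (N.compl₁₂ ψ (TensorProduct.map Φ.toLinearMap Φ.toLinearMap))
          (TensorProduct.assoc K _ _ _ (u ⊗ₜ c)) := by
      intro u c
      induction u using TensorProduct.induction_on with
      | zero => simp
      | add x y hx hy => simp only [map_add, TensorProduct.add_tmul, hx, hy]
      | tmul a b => simp [hN]
    have h' := congr(TensorProduct.lift (N.compl₁₂ ψ (TensorProduct.map Φ.toLinearMap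
      Φ.toLinearMap)) $(Coalgebra.coassoc_apply (R := K) x))
    have h'' : ∑ i ∈ r.index, Coalgebra.counit (R := K) (r.left i) • Φ (r.right i) = Φ x := by
      simp only [← map_smul, ← map_sum, Coalgebra.sum_counit_smul]
    rw [LinearMap.add_apply, actConv_apply _ _ _ r, LinearMap.comp_apply]
    rw [← r.eq] at h' ⊢
    simp only [map_sum, LinearMap.rTensor_tmul, LinearMap.lTensor_tmul, ← h,
      TensorProduct.map_tmul, TensorProduct.lift.tmul, LinearMap.compl₁₂_apply] at h' ⊢
    simp only [LinearMap.comp_apply, AlgHom.toLinearMap_apply, TensorProduct.mk_apply]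
    rw [← h', ← h'', TensorProduct.tmul_sum, ← Finset.sum_add_distrib]
    refine Finset.sum_congr rfl fun i _ => ?_
    conv_lhs => rw [hΦ, toQuasiShuffle_apply φ (r.left i), ← hΦ]
    rw [TensorProduct.add_tmul, TensorProduct.smul_tmul]
    rfl
  exact LinearMap.congr_fun (eq_of_eq_add_actConv N (letterPart_one φ) e1 e2) x

/-- The Hopf algebra morphism with a given projection to the letters. -/
noncomputable def toQuasiShuffleHom (m : D → D → Option D) [IsCommAssocBracket m]
    (φ : (NTree D →₀ K) →ₗ[K] (D →₀ K)) : CCK K D →ₐc[K] QuasiShuffle K m :=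
  BialgHom.ofAlgHom (toQuasiShuffle m φ) (AlgHom.ext fun x => counit_toQuasiShuffle φ x)
    (AlgHom.ext fun x => (comul_toQuasiShuffle φ x).symm)

/-! ### Uniqueness of the morphism. -/

/-- The decomposition of words by first letters, evaluated at `Φ x`, with the coproduct of `Φ x`
replaced by the image of that of `x`. -/
theorem eq_counit_add_actConv_of_bialgHom (Φ : CCK K D →ₐc[K] QuasiShuffle K m) :
    (Φ : CCK K D →ₗ[K] QuasiShuffle K m) =
      (Coalgebra.counit (R := K)).smulRight (1 : QuasiShuffle K m) +
        actConv consLin (proj ∘ₗ (Φ : CCK K D →ₗ[K] QuasiShuffle K m))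
          (Φ : CCK K D →ₗ[K] QuasiShuffle K m) := by
  ext x
  have r := Coalgebra.Repr.arbitrary K x
  have h := LinearMap.congr_fun (eq_counit_add_actConv (K := K) (m := m)) (Φ x)
  have h1 : counitLin (Φ x) = Coalgebra.counit (R := K) x := CoalgHomClass.counit_comp_apply Φ x
  rw [LinearMap.id_apply, LinearMap.add_apply, LinearMap.smulRight_apply, h1] at h
  refine h.trans (congrArg (Coalgebra.counit (R := K) x • (1 : QuasiShuffle K m) + ·) ?_)
  rw [actConv_apply _ _ _ r, actConv, LinearMap.comp_apply, ← CoalgHomClass.map_comp_comul_apply,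
    ← r.eq]
  simp

/-- Both sides obey the same product formula, vanish on scalars and equal `φ` on trees. -/
theorem proj_bialgHom_eq_letterPart {Φ : CCK K D →ₐc[K] QuasiShuffle K m}
    (hΦ : ∀ T, proj (Φ (X T)) = φ (Finsupp.single T 1)) (x : CCK K D) :
    proj (Φ x) = letterPart m φ x := by
  have hc : ∀ x, counitLin (Φ x) = Coalgebra.counit (R := K) x := fun x =>
    CoalgHomClass.counit_comp_apply Φ x
  induction x using induction_on with
  | hC a =>
    rw [Algebra.algebraMap_eq_smul_one, map_smul, map_smul, map_smul, map_one, proj_one,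
      letterPart_one]
  | hadd p q hp hq => rw [map_add, map_add, map_add, hp, hq]
  | hX p T hp =>
    have hT : proj (Φ (X T)) = letterPart m φ (X T) := by rw [letterPart_X, hΦ]
    rw [map_mul, proj_mul, letterPart_mul, hc, hc, hp, hT]

/-- Once the projections are identified, both morphisms solve the same recursion, which has at most
one solution. -/
theorem bialgHom_eq_toQuasiShuffle {Φ : CCK K D →ₐc[K] QuasiShuffle K m}
    (hΦ : ∀ T, proj (Φ (X T)) = φ (Finsupp.single T 1)) (x : CCK K D) :
    Φ x = toQuasiShuffle m φ x := by
  have hp : proj ∘ₗ (Φ : CCK K D →ₗ[K] QuasiShuffle K m) = letterPart m φ :=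
    LinearMap.ext fun x => proj_bialgHom_eq_letterPart φ hΦ x
  have h1 := eq_counit_add_actConv_of_bialgHom Φ
  rw [hp] at h1
  have h2 : (toQuasiShuffle m φ).toLinearMap =
      (Coalgebra.counit (R := K)).smulRight (1 : QuasiShuffle K m) +
      actConv consLin (letterPart m φ) (toQuasiShuffle m φ).toLinearMap :=
    LinearMap.ext fun x => toQuasiShuffle_apply φ x
  exact LinearMap.congr_fun
    (eq_of_eq_add_actConv (K := K) (D := D) (V := D →₀ K) (M := QuasiShuffle K m)
      consLin (letterPart_one φ) h1 h2) x

/-! ### Existence and uniqueness for an arbitrary bracket, then the two cases. -/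

/-- A Hopf algebra morphism from the algebra of contractions to a quasi-shuffle algebra is given
by the letters in the images of the trees. -/
theorem existsUnique_bialgHom (m : D → D → Option D) [IsCommAssocBracket m]
    (φ : (NTree D →₀ K) →ₗ[K] (D →₀ K)) :
    ∃! Φ : CCK K D →ₐc[K] QuasiShuffle K m,
      ∀ x : NTree D →₀ K, proj (Φ (incl x)) = φ x := by
  refine ⟨toQuasiShuffleHom m φ, fun x => ?_, fun Φ hΦ => BialgHom.ext fun x =>
    bialgHom_eq_toQuasiShuffle φ (fun T => by rw [← hΦ, incl_single]) x⟩
  induction x using Finsupp.induction_linear with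
  | zero => simp
  | add x y hx hy => simp only [map_add, hx, hy]
  | single T c =>
    rw [← Finsupp.smul_single_one, map_smul, map_smul, map_smul, map_smul, incl_single]
    exact congrArg (c • ·) ((proj_toQuasiShuffle φ _).trans (letterPart_X φ T))

end CCK

/-- The shuffle algebra comes from the bracket which is always `0`, the quasi-shuffle algebra from
the product of `D`. -/
theorem mainTheorem11 (K : Type*) [Field K] [CharZero K] (D : Type*) [Nonempty D]
    (φ : (NTree D →₀ K) →ₗ[K] (D →₀ K)) :
    (∃! Φ : CCK K D →ₐc[K] Sh K D,
      ∀ x : NTree D →₀ K, QuasiShuffle.proj (Φ (CCK.incl x)) = φ x) ∧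
    (∀ [CommSemigroup D], ∃! Φ : CCK K D →ₐc[K] Csh K D,
      ∀ x : NTree D →₀ K, QuasiShuffle.proj (Φ (CCK.incl x)) = φ x) :=
  ⟨CCK.existsUnique_bialgHom (zeroBracket D) φ, CCK.existsUnique_bialgHom (mulBracket D) φ⟩
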